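/- An abstract polyhedron is a poset with elements of ranks $0,1,2$ (vertices, edges, faces) such that every edge is incident to exactly two vertices and two faces, for every incident vertex and face exactly two edges are incident to both, the graph of the incidence relation is connected, and the neighbours of any vertex or face in this graph induce a connected subgraph. A flag is a mutually incident triple (vertex, edge, face); for $i\in\{0,1,2\}$, $\Phi^i$ is the flag differing from the flag $\Phi$ only in its element of rank $i$. The polyhedron has type $\{p,q\}$ if every face is incident to exactly $p$ edges and every vertex to exactly $q$ edges; it is tight if it then has exactly $2pq$ flags. It is chiral if its automorphism group has exactly two orbits on flags and adjacent flags $\Phi,\Phi^i$ always lie in different orbits. For a chiral polyhedron $\mathcal P$ with base flag $\Phi$, the rotation group is $\Gamma^+(\mathcal P)=\langle\sigma_1,\sigma_2\rangle$, where $\sigma_1$ and $\sigma_2$ are the automorphisms (acting on the right) sending $\Phi$ to $(\Phi^1)^0$ and to $(\Phi^2)^1$, respectively. A chiral polyhedron $\mathcal P$ covers a chiral polyhedron $\mathcal Q$ if, for some choice of base flags, there is a homomorphism $\Gamma^+(\mathcal P)\to\Gamma^+(\mathcal Q)$ sending $\sigma_1,\sigma_2$ to the corresponding generators of $\Gamma^+(\mathcal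 Q)$. A chiral polyhedron of type $\{p,q\}$ is atomic if it is tight and covers no tight chiral polyhedron of type $\{p',q\}$ with $p'<p$ or of type $\{p,q'\}$ with $q'<q$. Finally, for positive integers $p,q$ and integers $i_1,j_1,i_2,j_2$ let $$\Gamma^{p,q}(i_1,j_1,i_2,j_2)=\langle \sigma_1,\sigma_2 \mid \sigma_1^p=\sigma_2^q=(\sigma_1\sigma_2)^2=1,\ \sigma_2^{-1}\sigma_1=\sigma_1^{i_1}\sigma_2^{j_1},\ \sigma_2\sigma_1^{-1}=\sigma_1^{i_2}\sigma_2^{j_2}\rangle .$$ Theorem. Let $m$ be an odd prime, let $\alpha,\beta$ be positive integers, and let $\mathcal P$ be an atomic chiral polyhedron of type $\{2m^{\alpha},m^{\alpha+\beta}\}$. Then $\alpha=1$, and for every base flag there is an integer $k$ with $1\le k\le m-1$ such that $$\Gamma^+(\mathcal P)=\Gamma^{2m,\,m^{\beta+1}}(3,\ 1+km^{\beta},\ -3,\ -1+km^{\beta}),$$ that is, there is an isomorphism from the presented group onto $\Gamma^+(\mathcal P)$ sending the generators $\sigma_1,\sigma_2$ to the distinguished generators $\sigma_1,\sigma_2$.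 -/

import Mathlib

universe u

/-- The graph of the incidence relation of a poset: two different elements are joined when they
are comparable. -/
def incidenceGraph (X : Type u) [PartialOrder X] : SimpleGraph X where
  Adj x y := x < y ∨ y < x
  symm := ⟨fun _ _ h => h.symm⟩
  loopless := ⟨fun x h => h.elim (lt_irrefl x) (lt_irrefl x)⟩

/-- An abstract polyhedron: a poset ranked by `0` (vertices), `1` (edges), `2` (faces). -/
structure AbstractPolyhedron where
  carrier : Type u
  [order : PartialOrder carrier]
  rank : carrier → Fin 3
  rank_strictMono : StrictMono rank
  /-- Every edge is incident to exactly two vertices. -/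
  edge_vertices : ∀ e, rank e = 1 → {v | rank v = 0 ∧ v < e}.encard = 2
  /-- Every edge is incident to exactly two faces. -/
  edge_faces : ∀ e, rank e = 1 → {f | rank f = 2 ∧ e < f}.encard = 2
  /-- If a vertex and a face are incident, exactly two edges are incident to both. -/
  vertex_face_edges : ∀ v f, rank v = 0 → rank f = 2 → v < f →
    {e | rank e = 1 ∧ v < e ∧ e < f}.encard = 2
  /-- The graph of the incidence relation is connected. -/
  connected : (incidenceGraph carrier).Connected
  /-- The neighbours of a vertex or of a face induce a connected subgraph. -/
  link_connected : ∀ x, rank x ≠ 1 →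
    ((incidenceGraph carrier).induce ((incidenceGraph carrier).neighborSet x)).Connected

namespace AbstractPolyhedron

instance (P : AbstractPolyhedron.{u}) : PartialOrder P.carrier := P.order

/-- A flag: a mutually incident vertex, edge and face. -/
@[ext] structure Flag (P : AbstractPolyhedron.{u}) where
  vertex : P.carrier
  edge : P.carrier
  face : P.carrier
  rank_vertex : P.rank vertex = 0
  rank_edge : P.rank edge = 1
  rank_face : P.rank face = 2
  vertex_lt_edge : vertex < edge
  edge_lt_face : edge < face

/-- In a set with exactly two elements, each element has exactly one companion. -/
theorem existsUnique_other {X : Type u} {s : Set X} (h : s.encard = 2) {x : X} (hx : x ∈ s) :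
    ∃! y, y ∈ s ∧ y ≠ x := by
  obtain ⟨a, b, hab, rfl⟩ := Set.encard_eq_two.1 h
  rcases hx with rfl | rfl
  · exact ⟨b, ⟨Or.inr rfl, hab.symm⟩, fun y hy => hy.1.resolve_left hy.2⟩
  · exact ⟨a, ⟨Or.inl rfl, hab⟩, fun y hy => hy.1.resolve_right hy.2⟩

/-- The other element of a two-element set. -/
noncomputable def other {X : Type u} {s : Set X} (h : s.encard = 2) {x : X} (hx : x ∈ s) : X :=
  (existsUnique_other h hx).choose

theorem other_mem {X : Type u} {s : Set X} (h : s.encard = 2) {x : X} (hx : x ∈ s) :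
    other h hx ∈ s := (existsUnique_other h hx).choose_spec.1.1

theorem other_ne {X : Type u} {s : Set X} (h : s.encard = 2) {x : X} (hx : x ∈ s) :
    other h hx ≠ x := (existsUnique_other h hx).choose_spec.1.2

namespace Flag

variable {P : AbstractPolyhedron.{u}}

theorem mem_vertices (Φ : P.Flag) : Φ.vertex ∈ {v | P.rank v = 0 ∧ v < Φ.edge} :=
  ⟨Φ.rank_vertex, Φ.vertex_lt_edge⟩

theorem mem_edges (Φ : P.Flag) :
    Φ.edge ∈ {e | P.rank e = 1 ∧ Φ.vertex < e ∧ e < Φ.face} :=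
  ⟨Φ.rank_edge, Φ.vertex_lt_edge, Φ.edge_lt_face⟩

theorem mem_faces (Φ : P.Flag) : Φ.face ∈ {f | P.rank f = 2 ∧ Φ.edge < f} :=
  ⟨Φ.rank_face, Φ.edge_lt_face⟩

/-- The two edges incident to the vertex and the face of a flag. -/
theorem edges_encard (Φ : P.Flag) :
    {e | P.rank e = 1 ∧ Φ.vertex < e ∧ e < Φ.face}.encard = 2 :=
  P.vertex_face_edges _ _ Φ.rank_vertex Φ.rank_face (Φ.vertex_lt_edge.trans Φ.edge_lt_face)

/-- The flag `Φ⁰`, which differs from `Φ` only in its vertex. -/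
noncomputable def adj₀ (Φ : P.Flag) : P.Flag where
  vertex := other (P.edge_vertices _ Φ.rank_edge) Φ.mem_vertices
  edge := Φ.edge
  face := Φ.face
  rank_vertex := (other_mem (P.edge_vertices _ Φ.rank_edge) Φ.mem_vertices).1
  rank_edge := Φ.rank_edge
  rank_face := Φ.rank_face
  vertex_lt_edge := (other_mem (P.edge_vertices _ Φ.rank_edge) Φ.mem_vertices).2
  edge_lt_face := Φ.edge_lt_face

/-- The flag `Φ¹`, which differs from `Φ` only in its edge. -/
noncomputable def adj₁ (Φ : P.Flag) : P.Flag where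
  vertex := Φ.vertex
  edge := other Φ.edges_encard Φ.mem_edges
  face := Φ.face
  rank_vertex := Φ.rank_vertex
  rank_edge := (other_mem Φ.edges_encard Φ.mem_edges).1
  rank_face := Φ.rank_face
  vertex_lt_edge := (other_mem Φ.edges_encard Φ.mem_edges).2.1
  edge_lt_face := (other_mem Φ.edges_encard Φ.mem_edges).2.2

/-- The flag `Φ²`, which differs from `Φ` only in its face. -/
noncomputable def adj₂ (Φ : P.Flag) : P.Flag where
  vertex := Φ.vertex
  edge := Φ.edge
  face := other (P.edge_faces _ Φ.rank_edge) Φ.mem_faces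
  rank_vertex := Φ.rank_vertex
  rank_edge := Φ.rank_edge
  rank_face := (other_mem (P.edge_faces _ Φ.rank_edge) Φ.mem_faces).1
  vertex_lt_edge := Φ.vertex_lt_edge
  edge_lt_face := (other_mem (P.edge_faces _ Φ.rank_edge) Φ.mem_faces).2

end Flag

theorem rank_eq_zero_iff (P : AbstractPolyhedron.{u}) (x : P.carrier) :
    P.rank x = 0 ↔ IsMin x := by
  rw [isMin_iff_forall_not_lt]
  constructor
  · intro hx y hy
    have := P.rank_strictMono hy
    simp [hx] at this
  · intro hx
    by_contra h0
    by_cases h1 : P.rank x = 1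
    · have h2 := P.edge_vertices x h1
      have hne : {v | P.rank v = 0 ∧ v < x}.Nonempty := by
        rw [← Set.encard_ne_zero, h2]; simp
      obtain ⟨v, hv⟩ := hne
      exact hx v hv.2
    · obtain ⟨y, hy⟩ := (P.link_connected x h1).nonempty
      rcases hy with hy | hy
      · have := P.rank_strictMono hy
        omega
      · exact hx y hy

theorem rank_eq_two_iff (P : AbstractPolyhedron.{u}) (x : P.carrier) :
    P.rank x = 2 ↔ IsMax x := by
  rw [isMax_iff_forall_not_lt]
  constructor
  · intro hx y hy
    have := P.rank_strictMono hy
    omega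
  · intro hx
    by_contra h0
    by_cases h1 : P.rank x = 1
    · have h2 := P.edge_faces x h1
      have hne : {f | P.rank f = 2 ∧ x < f}.Nonempty := by
        rw [← Set.encard_ne_zero, h2]; simp
      obtain ⟨v, hv⟩ := hne
      exact hx v hv.2
    · obtain ⟨y, hy⟩ := (P.link_connected x h1).nonempty
      rcases hy with hy | hy
      · exact hx y hy
      · have := P.rank_strictMono hy
        omega

/-- Order automorphisms preserve ranks. -/
theorem rank_apply (P : AbstractPolyhedron.{u}) (g : P.carrier ≃o P.carrier) (x : P.carrier) :
    P.rank (g x) = P.rank x := by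
  have h0 : P.rank (g x) = 0 ↔ P.rank x = 0 := by
    rw [rank_eq_zero_iff, rank_eq_zero_iff, g.isMin_apply]
  have h2 : P.rank (g x) = 2 ↔ P.rank x = 2 := by
    rw [rank_eq_two_iff, rank_eq_two_iff, g.isMax_apply]
  omega

/-- The automorphism group, acting on the right: in a product `g * h` the automorphism `g` is
applied first. -/
abbrev Aut (P : AbstractPolyhedron.{u}) : Type u := (P.carrier ≃o P.carrier)ᵐᵒᵖ

/-- The image of a flag under an automorphism. -/
def Flag.image {P : AbstractPolyhedron.{u}} (Φ : P.Flag) (g : P.Aut) : P.Flag where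
  vertex := g.unop Φ.vertex
  edge := g.unop Φ.edge
  face := g.unop Φ.face
  rank_vertex := by rw [rank_apply, Φ.rank_vertex]
  rank_edge := by rw [rank_apply, Φ.rank_edge]
  rank_face := by rw [rank_apply, Φ.rank_face]
  vertex_lt_edge := g.unop.lt_iff_lt.2 Φ.vertex_lt_edge
  edge_lt_face := g.unop.lt_iff_lt.2 Φ.edge_lt_face

/-- The polyhedron has type (Schläfli symbol) `{p, q}`: every face is incident to exactly `p`
edges and every vertex to exactly `q` edges. -/
def HasType (P : AbstractPolyhedron.{u}) (p q : ℕ) : Prop :=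
  (∀ f, P.rank f = 2 → {e | P.rank e = 1 ∧ e < f}.encard = p) ∧
  (∀ v, P.rank v = 0 → {e | P.rank e = 1 ∧ v < e}.encard = q)

/-- A polyhedron of type `{p, q}` is tight if it has exactly `2pq` flags. -/
def IsTight (P : AbstractPolyhedron.{u}) : Prop :=
  ∃ p q : ℕ, P.HasType p q ∧ ENat.card P.Flag = ((2 * p * q : ℕ) : ℕ∞)

/-- The polyhedron is chiral: the flags fall into two classes (`C` and its complement) such that
two flags are related by an automorphism exactly when they lie in the same class, and adjacent
flags lie in different classes. -/
def IsChiral (P : AbstractPolyhedron.{u}) : Prop :=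
  ∃ C : Set P.Flag,
    (∀ Φ Ψ : P.Flag, (∃ g : P.Aut, Φ.image g = Ψ) ↔ (Φ ∈ C ↔ Ψ ∈ C)) ∧
    (∀ Φ : P.Flag, (Φ.adj₀ ∈ C ↔ Φ ∉ C) ∧ (Φ.adj₁ ∈ C ↔ Φ ∉ C) ∧ (Φ.adj₂ ∈ C ↔ Φ ∉ C))

/-- The distinguished generators of the rotation group with respect to the base flag `Φ`:
`σ₁` sends `Φ` to `(Φ¹)⁰` and `σ₂` sends `Φ` to `(Φ²)¹`. -/
structure Rotations {P : AbstractPolyhedron.{u}} (Φ : P.Flag) where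
  σ₁ : P.Aut
  σ₂ : P.Aut
  image_σ₁ : Φ.image σ₁ = Φ.adj₁.adj₀
  image_σ₂ : Φ.image σ₂ = Φ.adj₂.adj₁

namespace Rotations

variable {P : AbstractPolyhedron.{u}} {Φ : P.Flag}

/-- The rotation group `Γ⁺(P) = ⟨σ₁, σ₂⟩`. -/
def group (R : Rotations Φ) : Subgroup P.Aut := Subgroup.closure {R.σ₁, R.σ₂}

/-- `σ₁` as an element of the rotation group. -/
def gen₁ (R : Rotations Φ) : R.group := ⟨R.σ₁, Subgroup.subset_closure (Or.inl rfl)⟩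

/-- `σ₂` as an element of the rotation group. -/
def gen₂ (R : Rotations Φ) : R.group := ⟨R.σ₂, Subgroup.subset_closure (Or.inr rfl)⟩

end Rotations

/-- `P` covers `Q`: for some choice of base flags there is a homomorphism `Γ⁺(P) → Γ⁺(Q)` that
sends each distinguished generator to the corresponding one. -/
def Covers (P Q : AbstractPolyhedron.{u}) : Prop :=
  ∃ (Φ : P.Flag) (Ψ : Q.Flag) (R : Rotations Φ) (S : Rotations Ψ) (h : R.group →* S.group),
    h R.gen₁ = S.gen₁ ∧ h R.gen₂ = S.gen₂

/-- `P` is an atomic chiral polyhedron of type `{p, q}`: it is chiral and tight, and covers no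
tight chiral polyhedron of type `{p', q}` with `p' < p` or of type `{p, q'}` with `q' < q`. -/
def IsAtomicChiral (P : AbstractPolyhedron.{u}) (p q : ℕ) : Prop :=
  P.HasType p q ∧ P.IsChiral ∧ P.IsTight ∧
  ∀ Q : AbstractPolyhedron.{u}, Q.IsChiral → Q.IsTight →
    ((∃ p' < p, Q.HasType p' q) ∨ (∃ q' < q, Q.HasType p q')) → ¬ P.Covers Q

end AbstractPolyhedron

/-- The generators of `TightGroup`: `false` for `σ₁` and `true` for `σ₂`. -/
abbrev tightFree₁ : FreeGroup Bool := FreeGroup.of false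

/-- See `tightFree₁`. -/
abbrev tightFree₂ : FreeGroup Bool := FreeGroup.of true

/-- The defining relators of `Γ^{p,q}(i₁, j₁, i₂, j₂)`: `σ₁^p = σ₂^q = (σ₁σ₂)² = 1`,
`σ₂⁻¹σ₁ = σ₁^{i₁}σ₂^{j₁}` and `σ₂σ₁⁻¹ = σ₁^{i₂}σ₂^{j₂}`. -/
def tightRelators (p q : ℕ) (i₁ j₁ i₂ j₂ : ℤ) : Set (FreeGroup Bool) :=
  {tightFree₁ ^ p,
   tightFree₂ ^ q,
   (tightFree₁ * tightFree₂) ^ 2,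
   (tightFree₂⁻¹ * tightFree₁) * (tightFree₁ ^ i₁ * tightFree₂ ^ j₁)⁻¹,
   (tightFree₂ * tightFree₁⁻¹) * (tightFree₁ ^ i₂ * tightFree₂ ^ j₂)⁻¹}

/-- The group `Γ^{p,q}(i₁, j₁, i₂, j₂)`. -/
abbrev TightGroup (p q : ℕ) (i₁ j₁ i₂ j₂ : ℤ) : Type :=
  PresentedGroup (tightRelators p q i₁ j₁ i₂ j₂)

/-- `Γ⁺(P) = Γ^{p,q}(i₁, j₁, i₂, j₂)` with respect to the base flag `Φ`: the distinguished
rotations `σ₁, σ₂` exist, and some isomorphism from the presented group to the rotation group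
sends the generators to them. -/
def AbstractPolyhedron.RotationGroupEq {P : AbstractPolyhedron.{u}} (Φ : P.Flag)
    (p q : ℕ) (i₁ j₁ i₂ j₂ : ℤ) : Prop :=
  ∃ (R : AbstractPolyhedron.Rotations Φ) (e : TightGroup p q i₁ j₁ i₂ j₂ ≃* R.group),
    e (PresentedGroup.of false) = R.gen₁ ∧ e (PresentedGroup.of true) = R.gen₂

/-! Write `a`, `b` for the distinguished generators. For a chiral polyhedron the flags correspond to
two copies of the rotation group, so tightness means that the group is an exact product `⟨a⟩⟨b⟩`,
and chirality means that no endomorphism inverts both generators. Conversely, every such exact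
product with `(ab)² = 1` and `a, b ≠ 1` is the rotation group of a coset polyhedron. Atomicity
therefore becomes a statement about groups: dividing by a nontrivial normal subgroup of `⟨a⟩` or of
`⟨b⟩` that leaves both generators nontrivial always produces a reflection.

The group has order `2m^(2α+β)`, so its Sylow `m`-subgroup `S` has index 2 and contains `b` and
`a²`. If a quotient has a reflection, then `b` and `a²` commute in it: in a nilpotent group of odd
order, a commutator expressed as `b^i s^j` compatibly with inverting `b` and `s` is trivial
(`commute_of_commutatorElement_eq`, by induction along central quotients).

Since `β ≥ 1`, `S` is too small for `⟨b⟩` and its conjugate by `a` to meet trivially. Hence the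
subgroup `⟨w⟩` of order `m` in `⟨b⟩` is normal, and Fermat's little theorem shows that `a²`
centralizes it. The quotient by `⟨w⟩` has a reflection, so `z = [b, a²]` is a power of `w`; it is
not 1, because `b` and `a²` commuting would give a reflection. If `α ≥ 2`, then `z^m = 1` makes
`a^(2m)` a nontrivial central element, and the quotient by it forces `z ∈ ⟨a⟩ ∩ ⟨b⟩ = 1`, a
contradiction. So `α = 1` and `z = b^(k m^β)`. With `(ab)² = 1` this yields the two defining
relations, and these already force the presented group to be a product of two cyclic groups, hence
no larger than the rotation group (`exists_mulEquiv`). -/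

/-- Some endomorphism inverts both `a` and `b`. -/
def HasReflection {G : Type*} [Group G] (a b : G) : Prop :=
  ∃ ρ : G →* G, ρ a = a⁻¹ ∧ ρ b = b⁻¹

/-- `G` is the exact product of the cyclic groups `⟨a⟩` and `⟨b⟩`, and `ab` squares to `1`. -/
structure IsTightPair {G : Type*} [Group G] (a b : G) : Prop where
  sq : (a * b) ^ 2 = 1
  disjoint : Disjoint (Subgroup.zpowers a) (Subgroup.zpowers b)
  exists_mul : ∀ x, ∃ i j : ℤ, x = a ^ i * b ^ j

open Subgroup
open scoped commutatorElement

/-! ### Commutators in nilpotent groups of odd order, and powers in cyclic groups -/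

/-- In a finite nilpotent group of odd order, `b` and `s` commute if inverting `b` and `s` is
compatible with one expression of their commutator as a product of powers. -/
theorem commute_of_commutatorElement_eq (M : Type*) [Group M] [Group.IsNilpotent M] (hfin : Finite M)
    (hM : Odd (Nat.card M)) (b s : M)
    (h : ∃ i j : ℤ, ⁅b, s⁆ = b ^ i * s ^ j ∧ ⁅b⁻¹, s⁻¹⁆ = b ^ (-i) * s ^ (-j)) :
    Commute b s := by
  revert b s hM
  revert hfin
  refine Group.nilpotent_center_quotient_ind (P := fun M _ _ => Finite M → Odd (Nat.card M) →
    ∀ b s : M, (∃ i j : ℤ, ⁅b, s⁆ = b ^ i * s ^ j ∧ ⁅b⁻¹, s⁻¹⁆ = b ^ (-i) * s ^ (-j)) →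
    Commute b s) M ?_ ?_
  · intro G _ _ _ _ b s _
    exact Subsingleton.elim _ _
  · intro G _ _ ih hfin hodd b s h
    obtain ⟨i, j, h1, h2⟩ := h
    have hodd' : Odd (Nat.card (G ⧸ center G)) :=
      Odd.of_dvd_nat hodd (card_quotient_dvd_card _)
    have hc : Commute (b : G ⧸ center G) (s : G ⧸ center G) := by
      refine ih inferInstance hodd' b s ⟨i, j, ?_, ?_⟩
      · have := congrArg (QuotientGroup.mk' (center G)) h1
        simpa [map_commutatorElement] using this
      · have := congrArg (QuotientGroup.mk' (center G)) h2
        simpa [map_commutatorElement] using this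
    -- The commutator vanishes modulo the center. Being central, it also equals `⁅b⁻¹, s⁻¹⁆`.
    have hz : ⁅b, s⁆ ∈ center G := by
      rw [← QuotientGroup.eq_one_iff]
      have := commutatorElement_eq_one_iff_commute.2 hc
      rw [← this]
      rfl
    obtain ⟨z, hzdef⟩ : ∃ z, z = ⁅b, s⁆ := ⟨_, rfl⟩
    rw [← hzdef] at hz h1
    have hcomm : ∀ g, g * z = z * g := Subgroup.mem_center_iff.1 hz
    have hbs : b * s = z * (s * b) := by rw [hzdef, commutatorElement_def]; group
    have hz' : ⁅b⁻¹, s⁻¹⁆ = z := by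
      rw [commutatorElement_def, inv_inv, inv_inv, mul_assoc, hbs, ← mul_assoc, hcomm]
      group
    have hbi : b ^ i = z * s ^ (-j) := by rw [h1]; group
    -- Inverting `b ^ i = z * s ^ (-j)` and substituting in the second expression for `z` leaves `z
    -- = z⁻¹`; odd order then gives `z = 1`.
    have hzz : z * z = 1 := by
      have e1 : b ^ (-i) = s ^ j * z⁻¹ := by rw [zpow_neg, hbi]; group
      have e2 : z = s ^ j * z⁻¹ * s ^ (-j) := by rw [← e1, ← h2, hz']
      have e3 : s ^ j * z⁻¹ = z⁻¹ * s ^ j := by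
        have := hcomm (s ^ j)
        rw [mul_inv_eq_iff_eq_mul, mul_assoc, this]; group
      rw [e3, mul_assoc, ← zpow_add, add_neg_cancel, zpow_zero, mul_one] at e2
      nth_rewrite 1 [e2]
      group
    have hz1 : z = 1 := by
      have h2 : orderOf z ∣ 2 := orderOf_dvd_of_pow_eq_one (by rw [sq, hzz])
      have h3 : orderOf z ∣ Nat.card G := orderOf_dvd_natCard z
      have : orderOf z ∣ 1 := by
        rw [← Nat.Coprime.gcd_eq_one (Nat.coprime_two_left.2 hodd)]
        exact Nat.dvd_gcd h2 h3
      exact orderOf_eq_one_iff.1 (Nat.dvd_one.1 this)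
    rw [hz1, one_mul] at hbs
    exact hbs

/-- A nontrivial power of an element of prime power order generates the subgroup of prime
order. -/
theorem exists_zpow_eq_pow_prime_pow {G : Type*} [Group G] {b : G} {m n : ℕ} (hm : m.Prime)
    (hb : orderOf b = m ^ (n + 1)) (i : ℤ) (hi : b ^ i ≠ 1) :
    ∃ c : ℤ, (b ^ i) ^ c = b ^ (m ^ n) := by
  obtain ⟨s, hs, hgcd⟩ := (Nat.dvd_prime_pow hm).1
    (show Int.gcd i ((m ^ (n + 1) : ℕ) : ℤ) ∣ m ^ (n + 1) by
      have := Int.gcd_dvd_right i ((m ^ (n + 1) : ℕ) : ℤ)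
      exact_mod_cast this)
  -- The gcd of `i` with the order is `m ^ s`; the value `s = n + 1` would make `b ^ i` trivial.
  have hsn : s ≤ n := by
    by_contra hlt
    have hs' : s = n + 1 := by omega
    apply hi
    rw [← orderOf_dvd_iff_zpow_eq_one, hb, ← hs', ← hgcd]
    exact Int.gcd_dvd_left _ _
  have hbez := Int.gcd_eq_gcd_ab i ((m ^ (n + 1) : ℕ) : ℤ)
  rw [hgcd] at hbez
  -- The Bézout coefficient of `i` reaches the exponent `m ^ s`; the factor `m ^ (n - s)` lifts it
  -- to `m ^ n`.
  refine ⟨Int.gcdA i ((m ^ (n + 1) : ℕ) : ℤ) * (m ^ (n - s) : ℕ), ?_⟩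
  rw [← zpow_mul, ← zpow_natCast, zpow_eq_zpow_iff_modEq, hb]
  have hpow : ((m ^ n : ℕ) : ℤ) = ((m ^ s : ℕ) : ℤ) * ((m ^ (n - s) : ℕ) : ℤ) := by
    rw [← Nat.cast_mul, ← pow_add, Nat.add_sub_cancel' hsn]
  rw [hpow, hbez]
  refine (Int.modEq_iff_dvd.2 ⟨Int.gcdB i ((m ^ (n + 1) : ℕ) : ℤ) * (m ^ (n - s) : ℕ), ?_⟩)
  ring

theorem mul_swap_of_sq_eq_one {G : Type*} [Group G] {a b : G} (h : (a * b) ^ 2 = 1) :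
    b * a = a⁻¹ * b⁻¹ := by
  rw [pow_two] at h
  rw [← mul_inv_rev, ← mul_eq_one_iff_eq_inv]
  calc b * a * (b * a) = a⁻¹ * (a * b * (a * b)) * a := by
        simp only [mul_assoc, inv_mul_cancel_left]
    _ = 1 := by rw [h, mul_one, inv_mul_cancel]

/-! ### The Sylow `m`-subgroup of a tight pair and the subgroup of order `m` in `⟨b⟩` -/

namespace IsTightPair

variable {G : Type*} [Group G] {a b : G}

theorem eq_one_of_mem (h : IsTightPair a b) {x : G} (ha : x ∈ zpowers a) (hb : x ∈ zpowers b) :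
    x = 1 := Subgroup.disjoint_def.1 h.disjoint ha hb

theorem card_eq (h : IsTightPair a b) : Nat.card G = orderOf a * orderOf b := by
  rw [← Nat.card_zpowers, ← Nat.card_zpowers, ← Nat.card_prod]
  refine (Nat.card_eq_of_bijective _ ⟨mul_injective_of_disjoint h.disjoint, ?_⟩).symm
  intro x
  obtain ⟨i, j, rfl⟩ := h.exists_mul x
  exact ⟨⟨⟨a ^ i, i, rfl⟩, ⟨b ^ j, j, rfl⟩⟩, rfl⟩

variable {m α β : ℕ}

section

variable [Finite G] (h : IsTightPair a b) (hm : m.Prime) (hodd : Odd m)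
  (ha : orderOf a = 2 * m ^ α) (hb : orderOf b = m ^ (α + β))

-- As `m` is odd, a Sylow `m`-subgroup containing `b` has index 2, so it is normal and contains
-- every square. It misses `a`, whose order is even, so only even powers of `a` occur in the
-- factorizations of its elements.
include h hm hodd ha hb in
theorem exists_pSubgroup : ∃ S : Subgroup G, IsPGroup m S ∧ Nat.card S = m ^ (2 * α + β) ∧
    b ∈ S ∧ S.Normal ∧ a ^ 2 ∈ S ∧ ∀ x ∈ S, ∃ i j : ℤ, x = (a ^ 2) ^ i * b ^ j := by
  have : Fact m.Prime := ⟨hm⟩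
  have hbp : IsPGroup m (zpowers b) := by
    rw [IsPGroup.iff_card]; exact ⟨_, by rw [Nat.card_zpowers, hb]⟩
  obtain ⟨S, hS⟩ := hbp.exists_le_sylow
  have hcard : Nat.card G = 2 * m ^ (2 * α + β) := by
    rw [h.card_eq, ha, hb, mul_assoc, ← pow_add]; congr 2; omega
  have hm2 : m ≠ 2 := by rintro rfl; exact absurd hodd (by decide)
  have hSc : Nat.card (S : Subgroup G) = m ^ (2 * α + β) := by
    rw [S.card_eq_multiplicity, hcard, Nat.factorization_mul (by norm_num)
      (pow_ne_zero _ hm.ne_zero), Nat.Prime.factorization_pow hm]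
    simp [Nat.Prime.factorization Nat.prime_two, hm2.symm]
  have hidx : (S : Subgroup G).index = 2 := by
    have := card_mul_index (S : Subgroup G)
    rw [hSc, hcard, mul_comm 2 (m ^ _)] at this
    exact Nat.eq_of_mul_eq_mul_left (pow_pos hm.pos _) this
  have haS : a ∉ (S : Subgroup G) := by
    intro hmem
    have h1 := Subgroup.orderOf_dvd_natCard (S : Subgroup G) hmem
    rw [hSc, ha] at h1
    have h2 : 2 ∣ m ^ (2 * α + β) := (Dvd.intro _ rfl).trans h1
    have := (Nat.prime_dvd_prime_iff_eq Nat.prime_two hm).1 (Nat.prime_two.dvd_of_dvd_pow h2)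
    exact hm2 this.symm
  have hbS : b ∈ (S : Subgroup G) := hS (mem_zpowers b)
  have ha2 : a ^ 2 ∈ (S : Subgroup G) := sq_mem_of_index_two hidx a
  refine ⟨S, S.isPGroup', hSc, hbS, normal_of_index_eq_two hidx, ha2, ?_⟩
  intro x hx
  obtain ⟨i, j, rfl⟩ := h.exists_mul x
  have hai : a ^ i ∈ (S : Subgroup G) := (mul_mem_cancel_right (zpow_mem hbS j)).1 hx
  rcases Int.even_or_odd' i with ⟨k, rfl | rfl⟩
  · exact ⟨k, j, by rw [← zpow_natCast, ← zpow_mul]; norm_num⟩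
  · exfalso
    apply haS
    have : a = a ^ (2 * k + 1) * (a ^ 2) ^ (-k) := by
      rw [← zpow_natCast, ← zpow_mul, ← zpow_add]
      have : 2 * k + 1 + ((2 : ℕ) : ℤ) * -k = 1 := by push_cast; ring
      rw [this, zpow_one]
    rw [this]
    exact mul_mem hai (zpow_mem ha2 _)

include h hm hodd ha hb in
/-- If a quotient has a reflection, then `b` and `a²` commute in it. -/
theorem commutator_mem_of_hasReflection (N : Subgroup G) [N.Normal]
    (hN : HasReflection (a : G ⧸ N) (b : G ⧸ N)) : ⁅b, a ^ 2⁆ ∈ N := by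
  have : Fact m.Prime := ⟨hm⟩
  obtain ⟨S, hS, -, hbS, -, haS, hfac⟩ := h.exists_pSubgroup hm hodd ha hb
  have hz : ⁅b, a ^ 2⁆ ∈ S := by
    rw [commutatorElement_def]
    exact mul_mem (mul_mem (mul_mem hbS haS) (inv_mem hbS)) (inv_mem haS)
  -- Factoring the inverse commutator and inverting back puts the power of `b` first, as the
  -- commutation lemma requires.
  obtain ⟨j, i, hij⟩ := hfac _ (inv_mem hz)
  have hij' : ⁅b, a ^ 2⁆ = b ^ (-i) * (a ^ 2) ^ (-j) := by
    rw [← inv_inv ⁅b, a ^ 2⁆, hij]; group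
  obtain ⟨ρ, hρa, hρb⟩ := hN
  have e1 : ⁅(b : G ⧸ N), (a : G ⧸ N) ^ 2⁆ = (b : G ⧸ N) ^ (-i) * ((a : G ⧸ N) ^ 2) ^ (-j) := by
    have := congrArg (QuotientGroup.mk' N) hij'
    simpa [map_commutatorElement] using this
  have e2 : ⁅(b : G ⧸ N)⁻¹, ((a : G ⧸ N) ^ 2)⁻¹⁆ =
      (b : G ⧸ N) ^ (-(-i)) * ((a : G ⧸ N) ^ 2) ^ (-(-j)) := by
    have := congrArg ρ e1
    rw [map_commutatorElement, map_mul, map_zpow, map_zpow, map_pow, hρa, hρb, inv_pow,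
      inv_zpow', inv_zpow'] at this
    exact this
  have hT : IsPGroup m (S.map (QuotientGroup.mk' N)) := hS.map _
  have := hT.isNilpotent
  have hTodd : Odd (Nat.card (S.map (QuotientGroup.mk' N))) := by
    obtain ⟨n, hn⟩ := IsPGroup.iff_card.1 hT
    rw [hn]; exact hodd.pow
  have hc := commute_of_commutatorElement_eq _ inferInstance hTodd
    ⟨(b : G ⧸ N), b, hbS, rfl⟩ ⟨(a : G ⧸ N) ^ 2, a ^ 2, haS, rfl⟩
    ⟨-i, -j, Subtype.ext (by simpa [commutatorElement_def] using e1),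
      Subtype.ext (by simpa [commutatorElement_def] using e2)⟩
  have hc' : Commute (b : G ⧸ N) ((a : G ⧸ N) ^ 2) := congrArg Subtype.val hc
  rw [← QuotientGroup.eq_one_iff]
  have := commutatorElement_eq_one_iff_commute.2 hc'
  rw [← this]
  rfl

end

section

variable [Finite G] (h : IsTightPair a b) (hm : m.Prime) (hodd : Odd m) {n : ℕ}
  (ha : orderOf a = 2 * m ^ α) (hb : orderOf b = m ^ (α + β)) (hβ : 1 ≤ β) (hn : α + β = n + 1)

include h hm hodd ha hb hβ hn in
/-- Conjugation by `a` normalizes the subgroup of prime order of `⟨b⟩`. -/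
theorem exists_conj_eq_zpow : ∃ e : ℤ, a * b ^ (m ^ n) * a⁻¹ = (b ^ (m ^ n)) ^ e := by
  obtain ⟨S, -, hSc, hbS, hSn, -, -⟩ := h.exists_pSubgroup hm hodd ha hb
  have hb' : orderOf b = m ^ (n + 1) := by rw [hb, hn]
  -- Otherwise the products of elements of the two subgroups would be `m ^ (2 * (α + β))` distinct
  -- elements of `S`, which has only `m ^ (2 * α + β)`.
  have hnd : ¬ Disjoint (zpowers b) (zpowers (a * b * a⁻¹)) := by
    intro hd
    have hinj := mul_injective_of_disjoint hd
    have hc1 : orderOf (a * b * a⁻¹) = orderOf b := by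
      have := (MulAut.conj a).orderOf_eq b
      simpa using this
    have hle : Nat.card (zpowers b × zpowers (a * b * a⁻¹)) ≤ Nat.card S := by
      have h1 : zpowers b ≤ S := zpowers_le.2 hbS
      have h2 : zpowers (a * b * a⁻¹) ≤ S := zpowers_le.2 (hSn.conj_mem _ hbS _)
      refine Nat.card_le_card_of_injective
        (fun g => (⟨g.1 * g.2, mul_mem (h1 g.1.2) (h2 g.2.2)⟩ : S)) ?_
      intro x y hxy
      exact hinj (congrArg Subtype.val hxy)
    rw [Nat.card_prod, Nat.card_zpowers, Nat.card_zpowers, hc1, hb, hSc, ← pow_add,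
      Nat.pow_le_pow_iff_right hm.one_lt] at hle
    omega
  rw [Subgroup.disjoint_def] at hnd
  push Not at hnd
  obtain ⟨x, ⟨i, hi⟩, ⟨j, hj⟩, hx⟩ := hnd
  simp only at hi hj
  -- A power of the common element is `b ^ (m ^ n)`, which is thus the conjugate of the nontrivial
  -- `b ^ (j * c)`. Some power `d` of the latter is `b ^ (m ^ n)` again, and this `d` is the
  -- required exponent.
  obtain ⟨c, hc⟩ := exists_zpow_eq_pow_prime_pow hm hb' i (by rwa [hi])
  have hw : b ^ (m ^ n) = a * b ^ (j * c) * a⁻¹ := by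
    rw [← hc, hi, ← hj, zpow_mul, ← conj_zpow, ← conj_zpow]
  have hne : b ^ (j * c) ≠ 1 := by
    intro h1
    rw [h1, mul_one, mul_inv_cancel] at hw
    have := orderOf_dvd_of_pow_eq_one hw
    rw [hb', Nat.pow_dvd_pow_iff_le_right hm.one_lt] at this
    omega
  obtain ⟨d, hd⟩ := exists_zpow_eq_pow_prime_pow hm hb' (j * c) hne
  refine ⟨d, ?_⟩
  rw [← hd]
  nth_rewrite 2 [hd]
  rw [hw, conj_zpow]

-- If `a` conjugates `w = b ^ (m ^ n)` to `w ^ e`, then `a ^ (2 * m ^ α) = 1` gives `e ^ (2 * m ^ α)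
-- ≡ 1` modulo `m`. By Fermat, raising to the power `m ^ α` does nothing modulo `m`, so `e ^ 2 ≡ 1`.
include h hm hodd ha hb hβ hn in
theorem sq_commute_pow : Commute (a ^ 2) (b ^ (m ^ n)) := by
  have : Fact m.Prime := ⟨hm⟩
  obtain ⟨e, he⟩ := h.exists_conj_eq_zpow hm hodd ha hb hβ hn
  obtain ⟨w, hw⟩ : ∃ w, w = b ^ (m ^ n) := ⟨_, rfl⟩
  rw [← hw] at he ⊢
  have hk : ∀ k : ℕ, a ^ k * w * (a ^ k)⁻¹ = w ^ (e ^ k) := by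
    intro k
    induction k with
    | zero => simp
    | succ k ih =>
      rw [pow_succ' e, zpow_mul, ← he, conj_zpow, ← ih, pow_succ']
      group
  have how : orderOf w = m := by
    rw [hw, orderOf_pow' _ (pow_ne_zero _ hm.ne_zero), hb, hn,
      Nat.gcd_eq_right (pow_dvd_pow _ (Nat.le_succ n)), pow_succ,
      Nat.mul_div_cancel_left _ (pow_pos hm.pos _)]
  have h1 := hk (2 * m ^ α)
  rw [← ha, pow_orderOf_eq_one, one_mul, inv_one, mul_one, ha] at h1
  have h2 : e ^ (2 * m ^ α) ≡ 1 [ZMOD m] := by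
    have : w ^ (e ^ (2 * m ^ α)) = w ^ (1 : ℤ) := by rw [← h1, zpow_one]
    rw [zpow_eq_zpow_iff_modEq, how] at this
    exact this
  have h3 : e ^ 2 ≡ 1 [ZMOD m] := by
    rw [← ZMod.intCast_eq_intCast_iff] at h2 ⊢
    push_cast at h2 ⊢
    rw [pow_mul, ZMod.pow_card_pow] at h2
    exact h2
  have h4 : w ^ (e ^ 2) = w := by
    nth_rewrite 2 [← zpow_one w]
    rw [zpow_eq_zpow_iff_modEq, how]
    exact h3
  have h5 := hk 2
  rw [h4] at h5
  exact mul_inv_eq_iff_eq_mul.1 h5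

-- Both `b` and `a ^ 2` centralize the generator, so conjugation by `a ^ i * b ^ j` depends only on
-- the parity of `i`.
include h hm hodd ha hb hβ hn in
theorem zpowers_pow_normal : (zpowers (b ^ (m ^ n))).Normal := by
  obtain ⟨e, he⟩ := h.exists_conj_eq_zpow hm hodd ha hb hβ hn
  have hcom := h.sq_commute_pow hm hodd ha hb hβ hn
  obtain ⟨w, hw⟩ : ∃ w, w = b ^ (m ^ n) := ⟨_, rfl⟩
  have hbw : Commute b w := by rw [hw]; exact (Commute.refl b).pow_right _
  rw [← hw] at he hcom ⊢
  have hsq : ∀ k : ℤ, a ^ (2 * k) * w * (a ^ (2 * k))⁻¹ = w := by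
    intro k
    have : Commute (a ^ (2 * k)) w := by
      rw [zpow_mul]; exact_mod_cast hcom.zpow_left k
    rw [this.eq, mul_inv_cancel_right]
  have hconj : ∀ g : G, g * w * g⁻¹ ∈ zpowers w := by
    intro g
    obtain ⟨i, j, rfl⟩ := h.exists_mul g
    have e1 : a ^ i * b ^ j * w * (a ^ i * b ^ j)⁻¹ = a ^ i * w * (a ^ i)⁻¹ := by
      rw [mul_assoc (a ^ i), (hbw.zpow_left j).eq]; group
    rw [e1]
    rcases Int.even_or_odd' i with ⟨k, rfl | rfl⟩
    · rw [hsq]; exact mem_zpowers w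
    · have : a ^ (2 * k + 1) * w * (a ^ (2 * k + 1))⁻¹ =
          a * (a ^ (2 * k) * w * (a ^ (2 * k))⁻¹) * a⁻¹ := by
        rw [add_comm, zpow_add, zpow_one]; group
      rw [this, hsq, he]
      exact ⟨e, rfl⟩
  constructor
  rintro x ⟨c, rfl⟩ g
  simp only
  rw [← conj_zpow]
  exact zpow_mem (hconj g) c

end

end IsTightPair

/-! ### Normal forms, the presentation and its symmetry -/

/-- If `a²` normalizes `⟨b⟩` and `(ab)² = 1`, then `⟨a, b⟩ = ⟨a⟩⟨b⟩`. -/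
theorem exists_eq_zpow_mul_zpow {G : Type*} [Group G] {a b : G} {p q : ℕ} {r : ℤ}
    (hgen : closure {a, b} = ⊤) (hp : 0 < p) (hq : 0 < q) (ha : a ^ p = 1) (hb : b ^ q = 1)
    (hab : (a * b) ^ 2 = 1) (hr : b * a ^ 2 = a ^ 2 * b ^ r) (x : G) :
    ∃ i j : ℤ, x = a ^ i * b ^ j := by
  have hswap := mul_swap_of_sq_eq_one hab
  have h1 : ∀ j : ℤ, b ^ j * a ^ 2 = a ^ 2 * b ^ (r * j) := by
    intro j
    have e1 : (a ^ 2)⁻¹ * b * (a ^ 2)⁻¹⁻¹ = b ^ r := by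
      rw [inv_inv, mul_assoc, hr, inv_mul_cancel_left]
    rw [zpow_mul, ← e1, conj_zpow, inv_inv]
    group
  have h2 : ∀ (n : ℕ) (j : ℤ), ∃ l : ℤ, b ^ j * (a ^ 2) ^ n = (a ^ 2) ^ n * b ^ l := by
    intro n
    induction n with
    | zero => intro j; exact ⟨j, by simp⟩
    | succ n ih =>
      intro j
      obtain ⟨l, hl⟩ := ih (r * j)
      exact ⟨l, by rw [pow_succ', ← mul_assoc, h1, mul_assoc, hl, mul_assoc]⟩
  -- Powers of `b` have been moved past natural powers of `a ^ 2` only, so inverses are rewritten as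
  -- natural powers.
  have hinv : (a ^ 2)⁻¹ = (a ^ 2) ^ (p - 1) := by
    rw [inv_eq_iff_mul_eq_one, ← pow_succ', Nat.sub_add_cancel hp, ← pow_mul, mul_comm, pow_mul,
      ha, one_pow]
  -- Because `a⁻¹ * b * a = (a ^ 2)⁻¹ * b⁻¹`, these conjugates stay inside `⟨a²⟩⟨b⟩`. This is what
  -- allows a single `a` to pass a power of `b`.
  have h3 : ∀ n : ℕ, ∃ i l : ℤ, (a⁻¹ * b * a) ^ n = (a ^ 2) ^ i * b ^ l := by
    intro n
    induction n with
    | zero => exact ⟨0, 0, by simp⟩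
    | succ n ih =>
      obtain ⟨i, l, hil⟩ := ih
      obtain ⟨l', hl'⟩ := h2 (p - 1) l
      have e1 : a⁻¹ * b * a = (a ^ 2)⁻¹ * b⁻¹ := by
        rw [mul_assoc, hswap, pow_two]; group
      refine ⟨i + (p - 1 : ℕ), l' - 1, ?_⟩
      rw [pow_succ, hil, e1, hinv, mul_assoc, ← mul_assoc (b ^ l), hl', zpow_add, zpow_natCast,
        zpow_sub, zpow_one]
      group
  have h4 : ∀ j : ℤ, ∃ i l : ℤ, b ^ j * a = a ^ i * b ^ l := by
    intro j
    obtain ⟨n, hn⟩ : ∃ n : ℕ, b ^ j = b ^ n := by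
      refine ⟨(j % q).toNat, ?_⟩
      rw [← zpow_natCast, Int.toNat_of_nonneg (Int.emod_nonneg _ (by omega))]
      conv_lhs => rw [← Int.emod_add_mul_ediv j q, zpow_add, zpow_mul, zpow_natCast, hb, one_zpow,
        mul_one]
    obtain ⟨i, l, hil⟩ := h3 n
    refine ⟨1 + 2 * i, l, ?_⟩
    have e1 : b ^ n * a = a * (a⁻¹ * b * a) ^ n := by
      have := conj_pow (i := n) (a := a⁻¹) (b := b)
      rw [inv_inv] at this
      rw [this]; group
    rw [hn, e1, hil, zpow_add, zpow_one, zpow_mul, mul_assoc]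
    norm_cast
  have h5 : ∀ n : ℕ, ∀ i j : ℤ, ∃ i' j' : ℤ, a ^ i * b ^ j * a ^ n = a ^ i' * b ^ j' := by
    intro n
    induction n with
    | zero => intro i j; exact ⟨i, j, by simp⟩
    | succ n ih =>
      intro i j
      obtain ⟨k, l, hkl⟩ := h4 j
      obtain ⟨i', j', h'⟩ := ih (i + k) l
      exact ⟨i', j', by rw [pow_succ', ← mul_assoc, mul_assoc (a ^ i), hkl, ← h', zpow_add]; group⟩
  have hainv : a⁻¹ = a ^ (p - 1) := by
    rw [inv_eq_iff_mul_eq_one, ← pow_succ', Nat.sub_add_cancel hp, ha]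
  have hx : x ∈ closure {a, b} := hgen ▸ mem_top x
  induction hx using closure_induction_right with
  | one => exact ⟨0, 0, by simp⟩
  | mul_right x _ y hy ih =>
    obtain ⟨i, j, rfl⟩ := ih
    rcases hy with rfl | rfl
    · simpa using h5 1 i j
    · exact ⟨i, j + 1, by rw [zpow_add_one, mul_assoc]⟩
  | mul_inv_cancel x _ y hy ih =>
    obtain ⟨i, j, rfl⟩ := ih
    rcases hy with rfl | rfl
    · rw [hainv]; exact h5 _ i j
    · exact ⟨i, j - 1, by rw [zpow_sub_one, mul_assoc]⟩

theorem lift_eq_one_of_mem_tightRelators {G : Type*} [Group G] {f : Bool → G} {p q : ℕ}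
    {i₁ j₁ i₂ j₂ : ℤ} (ha : f false ^ p = 1) (hb : f true ^ q = 1)
    (hab : (f false * f true) ^ 2 = 1) (h₁ : (f true)⁻¹ * f false = f false ^ i₁ * f true ^ j₁)
    (h₂ : f true * (f false)⁻¹ = f false ^ i₂ * f true ^ j₂) :
    ∀ r ∈ tightRelators p q i₁ j₁ i₂ j₂, FreeGroup.lift f r = 1 := by
  rintro r (rfl | rfl | rfl | rfl | rfl)
  · simpa using ha
  · simpa using hb
  · simpa using hab
  · simp [h₁]
  · simp [h₂]

namespace IsTightPair

variable {G : Type*} [Group G] {a b : G}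

/-- A group factored by `⟨a⟩` and `⟨b⟩` in which the defining relations hold is the presented
group. -/
theorem exists_mulEquiv [Finite G] (h : IsTightPair a b) {p q : ℕ} (ha : orderOf a = p)
    (hb : orderOf b = q) (K : ℤ) (h₁ : b⁻¹ * a = a ^ (3 : ℤ) * b ^ (1 + K))
    (h₂ : b * a⁻¹ = a ^ (-3 : ℤ) * b ^ (-1 + K)) :
    ∃ e : TightGroup p q 3 (1 + K) (-3) (-1 + K) ≃* G,
      e (PresentedGroup.of false) = a ∧ e (PresentedGroup.of true) = b := by
  obtain ⟨f, hf⟩ : ∃ f : Bool → G, f = fun t => cond t b a := ⟨_, rfl⟩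
  have hrel : ∀ r ∈ tightRelators p q 3 (1 + K) (-3) (-1 + K), FreeGroup.lift f r = 1 := by
    apply lift_eq_one_of_mem_tightRelators <;> simp only [hf, cond]
    · rw [← ha, pow_orderOf_eq_one]
    · rw [← hb, pow_orderOf_eq_one]
    · exact h.sq
    · exact h₁
    · exact h₂
  let φ := PresentedGroup.toGroup hrel
  have hφa : φ (PresentedGroup.of false) = a := by simp [φ, hf]
  have hφb : φ (PresentedGroup.of true) = b := by simp [φ, hf]
  refine ⟨MulEquiv.ofBijective φ ⟨?_, ?_⟩, hφa, hφb⟩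
  · obtain ⟨A, hA⟩ : ∃ A : TightGroup p q 3 (1 + K) (-3) (-1 + K), A = PresentedGroup.of false :=
      ⟨_, rfl⟩
    obtain ⟨B, hB⟩ : ∃ B : TightGroup p q 3 (1 + K) (-3) (-1 + K), B = PresentedGroup.of true :=
      ⟨_, rfl⟩
    have hmk : ∀ r ∈ tightRelators p q 3 (1 + K) (-3) (-1 + K),
        PresentedGroup.mk (tightRelators p q 3 (1 + K) (-3) (-1 + K)) r = 1 := fun r hr =>
      PresentedGroup.one_of_mem hr
    have hAp : A ^ p = 1 := by rw [hA]; exact hmk _ (Or.inl rfl)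
    have hBq : B ^ q = 1 := by rw [hB]; exact hmk _ (Or.inr (Or.inl rfl))
    have hAB : (A * B) ^ 2 = 1 := by rw [hA, hB]; exact hmk _ (Or.inr (Or.inr (Or.inl rfl)))
    have hAB1 : (B⁻¹ * A) * (A ^ (3 : ℤ) * B ^ (1 + K))⁻¹ = 1 := by
      rw [hA, hB]; exact hmk _ (Or.inr (Or.inr (Or.inr (Or.inl rfl))))
    have hgen : closure {A, B} = ⊤ := by
      rw [← PresentedGroup.closure_range_of, hA, hB]
      congr 1
      ext x
      simp
    -- By `(AB)² = 1`, `B * A ^ 2 = A⁻¹ * (B⁻¹ * A)`, and the first tight relator evaluates the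
    -- bracket.
    have hr : B * A ^ 2 = A ^ 2 * B ^ (1 + K) := by
      rw [mul_inv_eq_one] at hAB1
      rw [pow_two, ← mul_assoc, mul_swap_of_sq_eq_one hAB, mul_assoc, hAB1]
      rw [← mul_assoc, ← zpow_neg_one A, ← zpow_add, ← pow_two]
      norm_cast
    have hA' : φ A = a := by rw [hA, hφa]
    have hB' : φ B = b := by rw [hB, hφb]
    rw [injective_iff_map_eq_one]
    intro x hx
    obtain ⟨i, j, rfl⟩ := exists_eq_zpow_mul_zpow hgen (ha ▸ orderOf_pos a) (hb ▸ orderOf_pos b)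
      hAp hBq hAB hr x
    rw [map_mul, map_zpow, map_zpow, hA', hB'] at hx
    -- An element `A ^ i * B ^ j` of the kernel has `a ^ i = b ^ (-j)`, so both are trivial. The
    -- exact orders `p`, `q` of `a`, `b` divide the exponents, and the relators kill `A ^ i` and `B
    -- ^ j`.
    have hai : a ^ i = 1 := by
      refine h.eq_one_of_mem ⟨i, rfl⟩ ⟨-j, ?_⟩
      simp only
      rw [zpow_neg]
      exact (mul_eq_one_iff_eq_inv.1 hx).symm
    have hbj : b ^ j = 1 := by rwa [hai, one_mul] at hx
    rw [← orderOf_dvd_iff_zpow_eq_one, ha] at hai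
    rw [← orderOf_dvd_iff_zpow_eq_one, hb] at hbj
    obtain ⟨i', rfl⟩ := hai
    obtain ⟨j', rfl⟩ := hbj
    rw [zpow_mul, zpow_mul, zpow_natCast, zpow_natCast, hAp, hBq, one_zpow, one_zpow, one_mul]
  · intro x
    obtain ⟨i, j, rfl⟩ := h.exists_mul x
    exact ⟨PresentedGroup.of false ^ i * PresentedGroup.of true ^ j, by
      rw [map_mul, map_zpow, map_zpow, hφa, hφb]⟩

/-- The defining relations in terms of the action of `a²` on `b`. -/
theorem relations_of_commutator (h : IsTightPair a b) {z : G} (hzb : Commute z b)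
    (hza : Commute z (a ^ 2)) (hz : b * a ^ 2 = a ^ 2 * b * z) :
    b⁻¹ * a = a ^ (3 : ℤ) * (b * z) ∧ b * a⁻¹ = a ^ (-3 : ℤ) * (b⁻¹ * z) := by
  have hswap := mul_swap_of_sq_eq_one h.sq
  constructor
  · have e1 : b * a ^ 2 = a⁻¹ * (b⁻¹ * a) := by
      rw [pow_two, ← mul_assoc, hswap, mul_assoc]
    rw [hz, eq_inv_mul_iff_mul_eq] at e1
    rw [← e1]
    group
  · have e1 : a * b * a⁻¹ = b⁻¹ * (a ^ 2)⁻¹ := by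
      have : b * (a * b * a⁻¹) = (a ^ 2)⁻¹ := by
        rw [← mul_assoc, ← mul_assoc, hswap, pow_two]; group
      rw [← this, inv_mul_cancel_left]
    -- Splitting `a ^ 3 * (b * a⁻¹)` as `a ^ 2 * (a * b * a⁻¹)` turns it into this conjugate of
    -- `b⁻¹`, by `e1`.
    have e2 : a ^ 2 * b⁻¹ * (a ^ 2)⁻¹ = b⁻¹ * z := by
      rw [mul_inv_eq_iff_eq_mul, mul_assoc, hza.eq]
      calc a ^ 2 * b⁻¹ = b⁻¹ * (b * a ^ 2) * b⁻¹ := by group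
        _ = b⁻¹ * (a ^ 2 * (b * z) * b⁻¹) := by rw [hz]; group
        _ = b⁻¹ * (a ^ 2 * z) := by rw [← hzb.eq]; group
    have e3 : a ^ (3 : ℤ) * (b * a⁻¹) = b⁻¹ * z := by
      rw [← e2, mul_assoc (a ^ 2), ← e1]; group
    rw [← e3, zpow_neg, inv_mul_cancel_left]

/-- Here the group has the presentation with `K = 0`. Inverting both generators exchanges its last
two relations and preserves the others, so inversion extends to the whole group. -/
theorem hasReflection_of_commute [Finite G] (h : IsTightPair a b) (hc : Commute b (a ^ 2)) :
    HasReflection a b := by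
  obtain ⟨r₁, r₂⟩ := h.relations_of_commutator (Commute.one_left b) (Commute.one_left _)
    (by rw [mul_one, hc.eq])
  rw [mul_one, ← zpow_one b] at r₁
  rw [mul_one, ← zpow_neg_one b] at r₂
  obtain ⟨e, hea, heb⟩ := h.exists_mulEquiv rfl rfl 0 (by simpa using r₁) (by simpa using r₂)
  obtain ⟨f, hf⟩ : ∃ f : Bool → G, f = fun t => cond t b⁻¹ a⁻¹ := ⟨_, rfl⟩
  have hrel : ∀ r ∈ tightRelators (orderOf a) (orderOf b) 3 (1 + 0) (-3) (-1 + 0),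
      FreeGroup.lift f r = 1 := by
    apply lift_eq_one_of_mem_tightRelators <;> simp only [hf, cond]
    · rw [inv_pow, pow_orderOf_eq_one, inv_one]
    · rw [inv_pow, pow_orderOf_eq_one, inv_one]
    · rw [pow_two]
      nth_rewrite 2 [← mul_swap_of_sq_eq_one h.sq]
      group
    · simpa using r₂
    · simpa using r₁
  refine ⟨(PresentedGroup.toGroup hrel).comp e.symm.toMonoidHom, ?_, ?_⟩
  · have : e.symm a = PresentedGroup.of false := e.symm_apply_eq.2 hea.symm
    simp [this, hf]
  · have : e.symm b = PresentedGroup.of true := e.symm_apply_eq.2 heb.symm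
    simp [this, hf]

end IsTightPair

/-! ### Tight pairs whose proper quotients have reflections -/

namespace IsTightPair

variable {G : Type*} [Group G] {a b : G}

/-- The group of a tight chiral pair of orders `2m^α` and `m^(α+β)` all of whose tight quotients
have reflections. -/
theorem relations_of_atomic [Finite G] (h : IsTightPair a b) {m α β : ℕ} (hm : m.Prime)
    (hodd : Odd m) (hα : 1 ≤ α) (hβ : 1 ≤ β) (ha : orderOf a = 2 * m ^ α)
    (hb : orderOf b = m ^ (α + β)) (hchiral : ¬ HasReflection a b)
    (hatom : ∀ (N : Subgroup G) [N.Normal], N ≠ ⊥ → (N ≤ zpowers a ∨ N ≤ zpowers b) →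
      a ∉ N → b ∉ N → HasReflection (a : G ⧸ N) (b : G ⧸ N)) :
    α = 1 ∧ ∃ k : ℕ, 1 ≤ k ∧ k ≤ m - 1 ∧
      b⁻¹ * a = a ^ (3 : ℤ) * b ^ (1 + (k : ℤ) * (m : ℤ) ^ β) ∧
      b * a⁻¹ = a ^ (-3 : ℤ) * b ^ (-1 + (k : ℤ) * (m : ℤ) ^ β) := by
  obtain ⟨n, hn⟩ : ∃ n, α + β = n + 1 := ⟨α + β - 1, by omega⟩
  have hcom := h.sq_commute_pow hm hodd ha hb hβ hn
  have hN := h.zpowers_pow_normal hm hodd ha hb hβ hn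
  -- As `n = α + β - 1`, this is a generator of the subgroup of order `m` of `⟨b⟩`.
  obtain ⟨w, hw⟩ : ∃ w, w = b ^ (m ^ n) := ⟨_, rfl⟩
  have how : orderOf w = m := by
    rw [hw, orderOf_pow' _ (pow_ne_zero _ hm.ne_zero), hb, hn,
      Nat.gcd_eq_right (pow_dvd_pow _ (Nat.le_succ n)), pow_succ,
      Nat.mul_div_cancel_left _ (pow_pos hm.pos _)]
  have hbw : Commute w b := by rw [hw]; exact (Commute.refl b).pow_left _
  have hb1 : b ≠ 1 := by
    rintro rfl
    rw [orderOf_one, hn] at hb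
    exact absurd hb.symm (Nat.one_lt_pow (by omega) hm.one_lt).ne'
  have ha1 : a ≠ 1 := by
    rintro rfl
    rw [orderOf_one] at ha
    omega
  rw [← hw] at hcom hN
  -- First use of atomicity. The generator `b` survives in the quotient because its order `m ^ (α +
  -- β)` has exponent at least 2.
  have hz : ⁅b, a ^ 2⁆ ∈ zpowers w := by
    refine h.commutator_mem_of_hasReflection hm hodd ha hb _ (hatom _ ?_ (Or.inr ?_) ?_ ?_)
    · intro h1
      rw [zpowers_eq_bot] at h1
      rw [h1, orderOf_one] at how
      exact hm.one_lt.ne how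
    · rw [zpowers_le, hw]; exact npow_mem_zpowers b _
    · intro hmem
      refine ha1 (h.eq_one_of_mem (mem_zpowers a) ?_)
      have : zpowers w ≤ zpowers b := by rw [zpowers_le, hw]; exact npow_mem_zpowers b _
      exact this hmem
    · intro hmem
      have := orderOf_dvd_of_mem_zpowers hmem
      rw [how, hb] at this
      nth_rewrite 2 [← pow_one m] at this
      rw [Nat.pow_dvd_pow_iff_le_right hm.one_lt] at this
      omega
  obtain ⟨c, hc⟩ := hz
  simp only at hc
  obtain ⟨z, hzdef⟩ : ∃ z, z = ⁅b, a ^ 2⁆ := ⟨_, rfl⟩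
  have hzw : z = w ^ c := by rw [hzdef, hc]
  have hzb : Commute z b := by rw [hzw]; exact hbw.zpow_left c
  have hza : Commute z (a ^ 2) := by rw [hzw]; exact hcom.symm.zpow_left c
  have hba : b * a ^ 2 = z * (a ^ 2 * b) := by rw [hzdef, commutatorElement_def]; group
  have hba' : b * a ^ 2 = a ^ 2 * b * z := by
    rw [hba, (hza.mul_right hzb).eq]
  have hz1 : z ≠ 1 := by
    intro h1
    rw [h1, one_mul] at hba
    exact hchiral (h.hasReflection_of_commute hba)
  have hα1 : α = 1 := by
    by_contra hne
    -- At `k = m` the factor `z ^ k` disappears, so `a ^ (2 * m)` commutes with `b` and is central.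
    have hbpow : ∀ k : ℕ, b * (a ^ 2) ^ k = z ^ k * ((a ^ 2) ^ k * b) := by
      intro k
      induction k with
      | zero => simp
      | succ k ih =>
        calc b * (a ^ 2) ^ (k + 1) = b * (a ^ 2) ^ k * a ^ 2 := by rw [pow_succ, mul_assoc]
          _ = z ^ k * (a ^ 2) ^ k * (b * a ^ 2) := by rw [ih]; simp only [mul_assoc]
          _ = z ^ k * ((a ^ 2) ^ k * z) * (a ^ 2 * b) := by rw [hba]; simp only [mul_assoc]
          _ = z ^ (k + 1) * ((a ^ 2) ^ (k + 1) * b) := by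
            rw [← (hza.pow_right k).eq, pow_succ z, pow_succ (a ^ 2)]; simp only [mul_assoc]
    have hzm : z ^ m = 1 := by
      rw [hzw, ← zpow_natCast, zpow_comm, zpow_natCast, ← how, pow_orderOf_eq_one, one_zpow]
    have hcb : Commute (a ^ (2 * m)) b := by
      have := hbpow m
      rw [hzm, one_mul, ← pow_mul] at this
      exact this.symm
    have hcent : a ^ (2 * m) ∈ center G := by
      rw [mem_center_iff]
      intro g
      obtain ⟨i, j, rfl⟩ := h.exists_mul g
      exact ((((Commute.refl a).pow_left _).zpow_right i).mul_right (hcb.zpow_right j)).symm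
    have hnorm : (zpowers (a ^ (2 * m))).Normal := by
      constructor
      intro x hx g
      have hx' : x ∈ center G := (zpowers_le.2 hcent) hx
      rw [mem_center_iff.1 hx' g, mul_inv_cancel_right]
      exact hx
    have hle : zpowers (a ^ (2 * m)) ≤ zpowers a := zpowers_le.2 (npow_mem_zpowers a _)
    -- Second use of atomicity: `α ≠ 1` makes this central subgroup nontrivial, and parity keeps `a`
    -- outside it. As `z` is also a power of `b`, it would be 1.
    have hmem : z ∈ zpowers (a ^ (2 * m)) := by
      rw [hzdef]
      refine h.commutator_mem_of_hasReflection hm hodd ha hb _ (hatom _ ?_ (Or.inl hle) ?_ ?_)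
      · intro h1
        rw [zpowers_eq_bot] at h1
        have := orderOf_dvd_of_pow_eq_one h1
        rw [ha] at this
        have := Nat.dvd_of_mul_dvd_mul_left two_pos this
        nth_rewrite 2 [← pow_one m] at this
        rw [Nat.pow_dvd_pow_iff_le_right hm.one_lt] at this
        omega
      · rintro ⟨k, hk⟩
        simp only at hk
        have h1 : a ^ (((2 * m : ℕ) : ℤ) * k - 1) = 1 := by
          rw [zpow_sub_one, zpow_mul, zpow_natCast, hk, mul_inv_cancel]
        rw [← orderOf_dvd_iff_zpow_eq_one, ha] at h1
        have h2 : (2 : ℤ) ∣ ((2 * m : ℕ) : ℤ) * k - 1 :=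
          (Dvd.intro (↑(m ^ α)) (by push_cast; ring)).trans h1
        have h3 : (2 : ℤ) ∣ ((2 * m : ℕ) : ℤ) * k := ⟨m * k, by push_cast; ring⟩
        omega
      · exact fun hmem => hb1 (h.eq_one_of_mem (hle hmem) (mem_zpowers b))
    refine hz1 (h.eq_one_of_mem (hle hmem) ?_)
    rw [hzw, hw]
    exact zpow_mem (npow_mem_zpowers b _) c
  refine ⟨hα1, ?_⟩
  have hnβ : n = β := by omega
  have hm0 : (m : ℤ) ≠ 0 := by exact_mod_cast hm.ne_zero
  have hk0 : 0 ≤ c % m := Int.emod_nonneg _ hm0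
  have hkm : c % m < m := Int.emod_lt_of_pos _ (by exact_mod_cast hm.pos)
  have hzk : z = w ^ (c % m) := by
    rw [hzw, zpow_eq_zpow_iff_modEq, how]
    exact (Int.mod_modEq c m).symm
  have hkne : c % m ≠ 0 := by
    intro h0
    rw [h0, zpow_zero] at hzk
    exact hz1 hzk
  -- The constant `k` is the residue of `c` modulo `m = orderOf w`; it is nonzero since `z ≠ 1`.
  have hzk' : z = b ^ (((c % m).toNat : ℤ) * (m : ℤ) ^ β) := by
    rw [hzk, hw, Int.toNat_of_nonneg hk0, hnβ, ← zpow_natCast, ← zpow_mul, mul_comm]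
    push_cast
    rfl
  obtain ⟨r₁, r₂⟩ := h.relations_of_commutator hzb hza hba'
  refine ⟨(c % m).toNat, by omega, by omega, ?_, ?_⟩
  · rw [r₁, zpow_add, zpow_one, ← hzk']
  · rw [r₂, zpow_add, zpow_neg_one, ← hzk']

end IsTightPair

/-! ### Adjacent flags, flag connectivity and automorphisms -/

namespace AbstractPolyhedron

theorem other_eq {X : Type u} {s : Set X} (h : s.encard = 2) {x y : X} (hx : x ∈ s) (hy : y ∈ s)
    (hne : y ≠ x) : other h hx = y :=
  (existsUnique_other h hx).unique ⟨other_mem h hx, other_ne h hx⟩ ⟨hy, hne⟩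

namespace Flag

variable {P : AbstractPolyhedron.{u}}

theorem adj₀_eq {Φ Ψ : P.Flag} (hv : Ψ.vertex ≠ Φ.vertex) (he : Ψ.edge = Φ.edge)
    (hf : Ψ.face = Φ.face) : Φ.adj₀ = Ψ :=
  Flag.ext (other_eq (P.edge_vertices _ Φ.rank_edge) Φ.mem_vertices
    ⟨Ψ.rank_vertex, he ▸ Ψ.vertex_lt_edge⟩ hv) he.symm hf.symm

theorem adj₁_eq {Φ Ψ : P.Flag} (hv : Ψ.vertex = Φ.vertex) (he : Ψ.edge ≠ Φ.edge)
    (hf : Ψ.face = Φ.face) : Φ.adj₁ = Ψ :=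
  Flag.ext hv.symm
    (other_eq Φ.edges_encard Φ.mem_edges
      ⟨Ψ.rank_edge, hv ▸ Ψ.vertex_lt_edge, hf ▸ Ψ.edge_lt_face⟩ he) hf.symm

theorem adj₂_eq {Φ Ψ : P.Flag} (hv : Ψ.vertex = Φ.vertex) (he : Ψ.edge = Φ.edge)
    (hf : Ψ.face ≠ Φ.face) : Φ.adj₂ = Ψ :=
  Flag.ext hv.symm he.symm (other_eq (P.edge_faces _ Φ.rank_edge) Φ.mem_faces
    ⟨Ψ.rank_face, he ▸ Ψ.edge_lt_face⟩ hf)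

theorem adj₀_vertex_ne (Φ : P.Flag) : Φ.adj₀.vertex ≠ Φ.vertex :=
  other_ne (P.edge_vertices _ Φ.rank_edge) Φ.mem_vertices

theorem adj₁_edge_ne (Φ : P.Flag) : Φ.adj₁.edge ≠ Φ.edge :=
  other_ne Φ.edges_encard Φ.mem_edges

theorem adj₂_face_ne (Φ : P.Flag) : Φ.adj₂.face ≠ Φ.face :=
  other_ne (P.edge_faces _ Φ.rank_edge) Φ.mem_faces

@[simp] theorem adj₀_adj₀ (Φ : P.Flag) : Φ.adj₀.adj₀ = Φ := adj₀_eq Φ.adj₀_vertex_ne.symm rfl rfl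

@[simp] theorem adj₁_adj₁ (Φ : P.Flag) : Φ.adj₁.adj₁ = Φ := adj₁_eq rfl Φ.adj₁_edge_ne.symm rfl

@[simp] theorem adj₂_adj₂ (Φ : P.Flag) : Φ.adj₂.adj₂ = Φ := adj₂_eq rfl rfl Φ.adj₂_face_ne.symm

theorem adj₀_adj₂ (Φ : P.Flag) : Φ.adj₀.adj₂ = Φ.adj₂.adj₀ :=
  adj₂_eq rfl rfl Φ.adj₂_face_ne

@[simp] theorem image_one (Φ : P.Flag) : Φ.image 1 = Φ := rfl

theorem image_mul (Φ : P.Flag) (g h : P.Aut) : Φ.image (g * h) = (Φ.image g).image h := rfl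

@[simp] theorem image_image_inv (Φ : P.Flag) (g : P.Aut) : (Φ.image g).image g⁻¹ = Φ := by
  rw [← image_mul, mul_inv_cancel, image_one]

theorem image_adj₀ (Φ : P.Flag) (g : P.Aut) : (Φ.image g).adj₀ = Φ.adj₀.image g :=
  adj₀_eq (fun h => Φ.adj₀_vertex_ne (g.unop.injective h)) rfl rfl

theorem image_adj₁ (Φ : P.Flag) (g : P.Aut) : (Φ.image g).adj₁ = Φ.adj₁.image g :=
  adj₁_eq rfl (fun h => Φ.adj₁_edge_ne (g.unop.injective h)) rfl

theorem image_adj₂ (Φ : P.Flag) (g : P.Aut) : (Φ.image g).adj₂ = Φ.adj₂.image g :=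
  adj₂_eq rfl rfl (fun h => Φ.adj₂_face_ne (g.unop.injective h))

theorem eq_or_adj₀ {Φ Ψ : P.Flag} (he : Ψ.edge = Φ.edge) (hf : Ψ.face = Φ.face) :
    Ψ = Φ ∨ Ψ = Φ.adj₀ := by
  by_cases hv : Ψ.vertex = Φ.vertex
  · exact Or.inl (Flag.ext hv he hf)
  · exact Or.inr (adj₀_eq hv he hf).symm

theorem eq_or_adj₁ {Φ Ψ : P.Flag} (hv : Ψ.vertex = Φ.vertex) (hf : Ψ.face = Φ.face) :
    Ψ = Φ ∨ Ψ = Φ.adj₁ := by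
  by_cases he : Ψ.edge = Φ.edge
  · exact Or.inl (Flag.ext hv he hf)
  · exact Or.inr (adj₁_eq hv he hf).symm

theorem eq_or_adj₂ {Φ Ψ : P.Flag} (hv : Ψ.vertex = Φ.vertex) (he : Ψ.edge = Φ.edge) :
    Ψ = Φ ∨ Ψ = Φ.adj₂ := by
  by_cases hf : Ψ.face = Φ.face
  · exact Or.inl (Flag.ext hv he hf)
  · exact Or.inr (adj₂_eq hv he hf).symm

/-- The element of rank `i` of a flag. -/
def elem (Φ : P.Flag) : Fin 3 → P.carrier := ![Φ.vertex, Φ.edge, Φ.face]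

/-- The flag that differs from `Φ` only in its element of rank `i`. -/
noncomputable def adj (Φ : P.Flag) : Fin 3 → P.Flag := ![Φ.adj₀, Φ.adj₁, Φ.adj₂]

theorem rank_elem (Φ : P.Flag) (i : Fin 3) : P.rank (Φ.elem i) = i := by
  fin_cases i
  exacts [Φ.rank_vertex, Φ.rank_edge, Φ.rank_face]

theorem elem_strictMono (Φ : P.Flag) : StrictMono Φ.elem := by
  have h1 := Φ.vertex_lt_edge
  have h2 := Φ.edge_lt_face
  intro i j hij
  fin_cases i <;> fin_cases j <;> first | exact absurd hij (by decide) | skip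
  exacts [h1, h1.trans h2, h2]

theorem adj_elem (Φ : P.Flag) {i j : Fin 3} (h : j ≠ i) : (Φ.adj j).elem i = Φ.elem i := by
  fin_cases i <;> fin_cases j <;> first | exact absurd rfl h | rfl

theorem image_elem (Φ : P.Flag) (g : P.Aut) (i : Fin 3) :
    (Φ.image g).elem i = g.unop (Φ.elem i) := by
  fin_cases i <;> rfl

theorem image_adj (Φ : P.Flag) (g : P.Aut) (i : Fin 3) :
    (Φ.image g).adj i = (Φ.adj i).image g := by
  fin_cases i
  exacts [Φ.image_adj₀ g, Φ.image_adj₁ g, Φ.image_adj₂ g]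

theorem ext_elem {Φ Ψ : P.Flag} (h : ∀ i, Φ.elem i = Ψ.elem i) : Φ = Ψ :=
  Flag.ext (h 0) (h 1) (h 2)

/-- A flag with the given elements. -/
def ofLT {x y z : P.carrier} (hxy : x < y) (hyz : y < z) : P.Flag :=
  have h1 := P.rank_strictMono hxy
  have h2 := P.rank_strictMono hyz
  ⟨x, y, z, by omega, by omega, by omega, hxy, hyz⟩

end Flag

variable (P : AbstractPolyhedron.{u})

theorem exists_face {e : P.carrier} (he : P.rank e = 1) : ∃ f, e < f := by
  have hne : {f | P.rank f = 2 ∧ e < f}.Nonempty := by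
    rw [← Set.encard_ne_zero, P.edge_faces e he]; simp
  exact hne.imp fun _ h => h.2

theorem exists_vertex {e : P.carrier} (he : P.rank e = 1) : ∃ v, v < e := by
  have hne : {v | P.rank v = 0 ∧ v < e}.Nonempty := by
    rw [← Set.encard_ne_zero, P.edge_vertices e he]; simp
  exact hne.imp fun _ h => h.2

/-- Two incident elements lie in a common flag. -/
theorem exists_flag_of_lt {x y : P.carrier} (h : x < y) :
    ∃ Φ : P.Flag, Φ.elem (P.rank x) = x ∧ Φ.elem (P.rank y) = y := by
  have hr := P.rank_strictMono h
  by_cases hy : P.rank y = 1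
  · obtain ⟨f, hf⟩ := P.exists_face hy
    have hx : P.rank x = 0 := by omega
    exact ⟨Flag.ofLT h hf, by rw [hx]; rfl, by rw [hy]; rfl⟩
  · have hy2 : P.rank y = 2 := by omega
    by_cases hx : P.rank x = 1
    · obtain ⟨v, hv⟩ := P.exists_vertex hx
      exact ⟨Flag.ofLT hv h, by rw [hx]; rfl, by rw [hy2]; rfl⟩
    · have hx0 : P.rank x = 0 := by omega
      have hne : {e | P.rank e = 1 ∧ x < e ∧ e < y}.Nonempty := by
        rw [← Set.encard_ne_zero, P.vertex_face_edges x y hx0 hy2 h]; simp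
      obtain ⟨e, -, h1, h2⟩ := hne
      exact ⟨Flag.ofLT h1 h2, by rw [hx0]; rfl, by rw [hy2]; rfl⟩

theorem exists_flag (x : P.carrier) : ∃ Φ : P.Flag, Φ.elem (P.rank x) = x := by
  by_cases hx : P.rank x = 1
  · obtain ⟨f, hf⟩ := P.exists_face hx
    exact (P.exists_flag_of_lt hf).imp fun _ h => h.1
  · obtain ⟨y, hy⟩ := (P.link_connected x hx).nonempty
    rcases hy with hy | hy
    · exact (P.exists_flag_of_lt hy).imp fun _ h => h.1
    · exact (P.exists_flag_of_lt hy).imp fun _ h => h.2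

instance : Nonempty P.Flag := by
  obtain ⟨x⟩ := P.connected.nonempty
  exact (P.exists_flag x).nonempty

variable {P}

theorem reachable_induction {X : Type*} {K : SimpleGraph X} {q : X → Prop}
    (h : ∀ x y, K.Adj x y → q x → q y) {x y : X} (hxy : K.Reachable x y) (hx : q x) : q y := by
  obtain ⟨w⟩ := hxy
  induction w with
  | nil => exact hx
  | cons hadj _ ih => exact ih (h _ _ hadj hx)

/-- Flags with a common vertex are connected by changes of edges and faces. -/
theorem Flag.induction_vertex {p : P.Flag → Prop} (h₁ : ∀ Φ, p Φ → p Φ.adj₁)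
    (h₂ : ∀ Φ, p Φ → p Φ.adj₂) {Φ Ψ : P.Flag} (hv : Ψ.vertex = Φ.vertex) (hΦ : p Φ) : p Ψ := by
  have hr : P.rank Φ.vertex ≠ 1 := by rw [Φ.rank_vertex]; decide
  have hlt : ∀ y, y ∈ (incidenceGraph P.carrier).neighborSet Φ.vertex → Φ.vertex < y := by
    rintro y (hy | hy)
    · exact hy
    · have := P.rank_strictMono hy
      rw [Φ.rank_vertex] at this
      exact absurd this (Fin.not_lt_zero _)
  -- A walk in the link alternates between edges and faces. The invariant carried along it is that
  -- `p` holds for every flag at the vertex through the current element.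
  refine reachable_induction
    (q := fun y : (incidenceGraph P.carrier).neighborSet Φ.vertex => ∀ Θ : P.Flag,
      Θ.vertex = Φ.vertex → (Θ.edge = y.1 ∨ Θ.face = y.1) → p Θ) ?_
    ((P.link_connected _ hr).preconnected ⟨Φ.edge, Or.inl Φ.vertex_lt_edge⟩
      ⟨Ψ.edge, Or.inl (hv ▸ Ψ.vertex_lt_edge)⟩) ?_ Ψ hv (Or.inl rfl)
  · rintro ⟨x, hx⟩ ⟨y, hy⟩ hadj hq Θ hΘ hΘy
    have hx' := P.rank_strictMono (hlt x hx)
    have hy' := P.rank_strictMono (hlt y hy)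
    have hadj' : x < y ∨ y < x := hadj
    simp only at hq hΘy
    rcases hadj' with hxy | hyx
    · have hr' := P.rank_strictMono hxy
      have h0 := hq (Flag.ofLT (hlt x hx) hxy) rfl (Or.inl rfl)
      rcases hΘy with h' | h'
      · have := Θ.rank_edge
        rw [h'] at this
        omega
      · rcases Flag.eq_or_adj₁ (Φ := Flag.ofLT (hlt x hx) hxy) (Ψ := Θ) hΘ h' with h | h
        · rw [h]; exact h0
        · rw [h]; exact h₁ _ h0
    · have hr' := P.rank_strictMono hyx
      have h0 := hq (Flag.ofLT (hlt y hy) hyx) rfl (Or.inr rfl)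
      rcases hΘy with h' | h'
      · rcases Flag.eq_or_adj₂ (Φ := Flag.ofLT (hlt y hy) hyx) (Ψ := Θ) hΘ h' with h | h
        · rw [h]; exact h0
        · rw [h]; exact h₂ _ h0
      · have := Θ.rank_face
        rw [h'] at this
        omega
  · intro Θ hΘ hΘe
    rcases hΘe with h' | h'
    · rcases Flag.eq_or_adj₂ hΘ h' with h | h
      · rw [h]; exact hΦ
      · rw [h]; exact h₂ _ hΦ
    · have h1 := Θ.rank_face
      have h2 := Φ.rank_edge
      simp only at h'
      rw [h', h2] at h1
      exact absurd h1 (by decide)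

/-- Flags with a common face are connected by changes of vertices and edges. -/
theorem Flag.induction_face {p : P.Flag → Prop} (h₀ : ∀ Φ, p Φ → p Φ.adj₀)
    (h₁ : ∀ Φ, p Φ → p Φ.adj₁) {Φ Ψ : P.Flag} (hf : Ψ.face = Φ.face) (hΦ : p Φ) : p Ψ := by
  have hr : P.rank Φ.face ≠ 1 := by rw [Φ.rank_face]; decide
  have hlt : ∀ y, y ∈ (incidenceGraph P.carrier).neighborSet Φ.face → y < Φ.face := by
    rintro y (hy | hy)
    · have := P.rank_strictMono hy
      rw [Φ.rank_face] at this
      omega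
    · exact hy
  refine reachable_induction
    (q := fun y : (incidenceGraph P.carrier).neighborSet Φ.face => ∀ Θ : P.Flag,
      Θ.face = Φ.face → (Θ.edge = y.1 ∨ Θ.vertex = y.1) → p Θ) ?_
    ((P.link_connected _ hr).preconnected ⟨Φ.edge, Or.inr Φ.edge_lt_face⟩
      ⟨Ψ.edge, Or.inr (hf ▸ Ψ.edge_lt_face)⟩) ?_ Ψ hf (Or.inl rfl)
  · rintro ⟨x, hx⟩ ⟨y, hy⟩ hadj hq Θ hΘ hΘy
    have hx' := P.rank_strictMono (hlt x hx)
    have hy' := P.rank_strictMono (hlt y hy)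
    have hadj' : x < y ∨ y < x := hadj
    simp only at hq hΘy
    rcases hadj' with hxy | hyx
    · have hr' := P.rank_strictMono hxy
      have h0 := hq (Flag.ofLT hxy (hlt y hy)) rfl (Or.inr rfl)
      rcases hΘy with h' | h'
      · rcases Flag.eq_or_adj₀ (Φ := Flag.ofLT hxy (hlt y hy)) (Ψ := Θ) h' hΘ with h | h
        · rw [h]; exact h0
        · rw [h]; exact h₀ _ h0
      · have := Θ.rank_vertex
        rw [h'] at this
        omega
    · have hr' := P.rank_strictMono hyx
      have h0 := hq (Flag.ofLT hyx (hlt x hx)) rfl (Or.inl rfl)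
      rcases hΘy with h' | h'
      · have := Θ.rank_edge
        rw [h'] at this
        omega
      · rcases Flag.eq_or_adj₁ (Φ := Flag.ofLT hyx (hlt x hx)) (Ψ := Θ) h' hΘ with h | h
        · rw [h]; exact h0
        · rw [h]; exact h₁ _ h0
  · intro Θ hΘ hΘe
    rcases hΘe with h' | h'
    · rcases Flag.eq_or_adj₀ h' hΘ with h | h
      · rw [h]; exact hΦ
      · rw [h]; exact h₀ _ hΦ
    · have h1 := Θ.rank_vertex
      have h2 := Φ.rank_edge
      simp only at h'
      rw [h', h2] at h1
      exact absurd h1 (by decide)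

/-- Flags with a common edge are connected by changes of vertices and faces. -/
theorem Flag.induction_edge {p : P.Flag → Prop} (h₀ : ∀ Φ, p Φ → p Φ.adj₀)
    (h₂ : ∀ Φ, p Φ → p Φ.adj₂) {Φ Ψ : P.Flag} (he : Ψ.edge = Φ.edge) (hΦ : p Φ) : p Ψ := by
  by_cases hf : Ψ.face = Φ.face
  · rcases Flag.eq_or_adj₀ he hf with rfl | rfl
    exacts [hΦ, h₀ _ hΦ]
  · have h2 : Φ.adj₂.face = Ψ.face :=
      other_eq (P.edge_faces _ Φ.rank_edge) Φ.mem_faces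
        ⟨Ψ.rank_face, he ▸ Ψ.edge_lt_face⟩ hf
    rcases Flag.eq_or_adj₀ (Φ := Φ.adj₂) he h2.symm with rfl | rfl
    exacts [h₂ _ hΦ, h₀ _ (h₂ _ hΦ)]

/-- Strong flag connectivity. -/
theorem Flag.induction_elem {p : P.Flag → Prop} {i : Fin 3}
    (h : ∀ j, j ≠ i → ∀ Φ, p Φ → p (Φ.adj j)) {Φ Ψ : P.Flag} (he : Ψ.elem i = Φ.elem i)
    (hΦ : p Φ) : p Ψ := by
  fin_cases i
  · exact Flag.induction_vertex (h 1 (by decide)) (h 2 (by decide)) he hΦ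
  · exact Flag.induction_edge (h 0 (by decide)) (h 2 (by decide)) he hΦ
  · exact Flag.induction_face (h 0 (by decide)) (h 1 (by decide)) he hΦ

/-- Flag connectivity. -/
theorem Flag.induction {p : P.Flag → Prop} (h : ∀ j Φ, p Φ → p (Φ.adj j)) {Φ : P.Flag} (hΦ : p Φ)
    (Ψ : P.Flag) : p Ψ := by
  -- The invariant says that `p` holds for all flags through `x`. Consecutive elements of the walk
  -- lie in a common flag, and strong connectivity spreads `p` from it to all flags through the next
  -- element.
  refine reachable_induction (q := fun x => ∀ Θ : P.Flag, Θ.elem (P.rank x) = x → p Θ) ?_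
    (P.connected.preconnected Φ.vertex Ψ.vertex) ?_ Ψ (by rw [Ψ.rank_vertex]; rfl)
  · intro x y hadj hq Θ hΘ
    have : ∃ Φ : P.Flag, Φ.elem (P.rank x) = x ∧ Φ.elem (P.rank y) = y := by
      rcases hadj with hxy | hyx
      · exact P.exists_flag_of_lt hxy
      · obtain ⟨Φ, h1, h2⟩ := P.exists_flag_of_lt hyx
        exact ⟨Φ, h2, h1⟩
    obtain ⟨Θ', hx, hy⟩ := this
    exact Flag.induction_elem (fun j _ => h j) (hΘ.trans hy.symm) (hq Θ' hx)
  · intro Θ hΘ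
    refine Flag.induction_elem (i := 0) (fun j _ => h j) ?_ hΦ
    rw [Φ.rank_vertex] at hΘ
    exact hΘ

/-- Automorphisms act freely on flags. -/
theorem Flag.image_injective (Φ : P.Flag) : Function.Injective Φ.image := by
  intro g h hgh
  have hall : ∀ Ψ : P.Flag, Ψ.image g = Ψ.image h := by
    refine fun Ψ => Flag.induction (p := fun Ψ => Ψ.image g = Ψ.image h) ?_ hgh Ψ
    intro j Ψ hΨ
    rw [← Flag.image_adj, hΨ, Flag.image_adj]
  refine MulOpposite.unop_injective (RelIso.ext fun x => ?_)
  obtain ⟨Ψ, hΨ⟩ := P.exists_flag x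
  rw [← hΨ, ← Flag.image_elem, hall, Flag.image_elem]

/-- An involution of the flags that preserves adjacency is induced by an automorphism. -/
theorem exists_aut_of_involution (f : P.Flag → P.Flag) (hf : ∀ i Φ, f (Φ.adj i) = (f Φ).adj i)
    (hinv : ∀ Φ, f (f Φ) = Φ) : ∃ g : P.Aut, ∀ Φ : P.Flag, Φ.image g = f Φ := by
  choose F hF using P.exists_flag
  -- Two flags sharing their element of rank `i` are joined by adjacencies of other ranks, and `f`
  -- respects these. Hence the image of an element does not depend on the flag chosen through it.
  have hwell : ∀ (i : Fin 3) (Φ Ψ : P.Flag), Ψ.elem i = Φ.elem i →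
      (f Ψ).elem i = (f Φ).elem i := by
    intro i Φ Ψ h
    refine Flag.induction_elem (p := fun Ψ => (f Ψ).elem i = (f Φ).elem i) ?_ h rfl
    intro j hj Θ hΘ
    rw [hf, Flag.adj_elem _ hj, hΘ]
  let g : P.carrier → P.carrier := fun x => (f (F x)).elem (P.rank x)
  have hg : ∀ (Φ : P.Flag) i, g (Φ.elem i) = (f Φ).elem i := by
    intro Φ i
    have h1 : g (Φ.elem i) = (f (F (Φ.elem i))).elem i := by
      simp only [g, Flag.rank_elem]
    rw [h1]
    apply hwell
    have := hF (Φ.elem i)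
    rwa [Flag.rank_elem] at this
  have hgg : ∀ x, g (g x) = x := by
    intro x
    have h1 := hg (F x) (P.rank x)
    rw [hF] at h1
    rw [h1, hg, hinv, hF]
  have hmono : ∀ x y, x < y → g x < g y := by
    intro x y hxy
    obtain ⟨Φ, hx, hy⟩ := P.exists_flag_of_lt hxy
    rw [← hx, ← hy, hg, hg]
    exact (f Φ).elem_strictMono (P.rank_strictMono hxy)
  have hmono' : Monotone g := by
    intro x y hxy
    rcases hxy.lt_or_eq with h | rfl
    exacts [(hmono _ _ h).le, le_rfl]
  let e : P.carrier ≃o P.carrier :=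
    { toFun := g
      invFun := g
      left_inv := hgg
      right_inv := hgg
      map_rel_iff' := by
        intro x y
        refine ⟨fun h => ?_, fun h => hmono' h⟩
        have := hmono' h
        simpa only [Equiv.coe_fn_mk, hgg] using this }
  refine ⟨MulOpposite.op e, fun Φ => Flag.ext_elem fun i => ?_⟩
  rw [Flag.image_elem]
  exact hg Φ i

end AbstractPolyhedron

/-! ### The rotation group and its action on flags -/

namespace AbstractPolyhedron

variable {P : AbstractPolyhedron.{u}}

namespace Rotations

variable {Φ : P.Flag} (R : Rotations Φ)

/-- With the next lemmas, this translates adjacency into the group: changing a flag amounts to a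
switch between the orbits of `Φ` and `Φ¹` and a left multiplication by 1 or by `σ₁` or `σ₂` or an
inverse. -/
theorem adj₀_eq : Φ.adj₀ = Φ.adj₁.image R.σ₁⁻¹ := by
  have : Φ.adj₀.image R.σ₁ = Φ.adj₁ := by
    rw [← Flag.image_adj₀, R.image_σ₁, Flag.adj₀_adj₀]
  rw [← this, Flag.image_image_inv]

theorem adj₂_eq : Φ.adj₂ = Φ.adj₁.image R.σ₂ := by
  rw [← Flag.image_adj₁, R.image_σ₂, Flag.adj₁_adj₁]

theorem adj₁_adj₂_eq : Φ.adj₁.adj₂ = Φ.image R.σ₂⁻¹ := by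
  have : Φ.adj₁.adj₂.image R.σ₂ = Φ := by
    rw [← Flag.image_adj₂, ← Flag.image_adj₁, R.image_σ₂, Flag.adj₁_adj₁, Flag.adj₂_adj₂]
  rw [← Flag.image_image_inv Φ.adj₁.adj₂ R.σ₂, this]

theorem image_adj₀ (g : P.Aut) : (Φ.image g).adj₀ = Φ.adj₁.image (R.σ₁⁻¹ * g) := by
  rw [Flag.image_adj₀, R.adj₀_eq, Flag.image_mul]

theorem image_adj₂ (g : P.Aut) : (Φ.image g).adj₂ = Φ.adj₁.image (R.σ₂ * g) := by
  rw [Flag.image_adj₂, R.adj₂_eq, Flag.image_mul]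

theorem image_adj₁_adj₀ (g : P.Aut) : (Φ.adj₁.image g).adj₀ = Φ.image (R.σ₁ * g) := by
  rw [Flag.image_adj₀, ← R.image_σ₁, Flag.image_mul]

theorem image_adj₁_adj₂ (g : P.Aut) : (Φ.adj₁.image g).adj₂ = Φ.image (R.σ₂⁻¹ * g) := by
  rw [Flag.image_adj₂, R.adj₁_adj₂_eq, Flag.image_mul]

theorem image_adj₁_adj₁ (g : P.Aut) : (Φ.adj₁.image g).adj₁ = Φ.image g := by
  rw [Flag.image_adj₁, Flag.adj₁_adj₁]

theorem image_vertex {g : P.Aut} (hg : g ∈ Subgroup.zpowers R.σ₂) (Ψ : P.Flag)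
    (hΨ : Ψ.vertex = Φ.vertex) : (Ψ.image g).vertex = Φ.vertex := by
  have h1 : R.σ₂.unop Φ.vertex = Φ.vertex := congrArg Flag.vertex R.image_σ₂
  have h2 : ∀ g ∈ Subgroup.zpowers R.σ₂, g.unop Φ.vertex = Φ.vertex := by
    intro g hg
    rw [Subgroup.zpowers_eq_closure] at hg
    induction hg using Subgroup.closure_induction with
    | mem x hx => rw [Set.mem_singleton_iff.1 hx, h1]
    | one => rfl
    | mul x y _ _ hx hy =>
      change y.unop (x.unop Φ.vertex) = _
      rw [hx, hy]
    | inv x _ hx => exact x.unop.symm_apply_eq.2 hx.symm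
  change g.unop Ψ.vertex = _
  rw [hΨ, h2 g hg]

theorem image_face {g : P.Aut} (hg : g ∈ Subgroup.zpowers R.σ₁) (Ψ : P.Flag)
    (hΨ : Ψ.face = Φ.face) : (Ψ.image g).face = Φ.face := by
  have h1 : R.σ₁.unop Φ.face = Φ.face := congrArg Flag.face R.image_σ₁
  have h2 : ∀ g ∈ Subgroup.zpowers R.σ₁, g.unop Φ.face = Φ.face := by
    intro g hg
    rw [Subgroup.zpowers_eq_closure] at hg
    induction hg using Subgroup.closure_induction with
    | mem x hx => rw [Set.mem_singleton_iff.1 hx, h1]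
    | one => rfl
    | mul x y _ _ hx hy =>
      change y.unop (x.unop Φ.face) = _
      rw [hx, hy]
    | inv x _ hx => exact x.unop.symm_apply_eq.2 hx.symm
  change g.unop Ψ.face = _
  rw [hΨ, h2 g hg]

/-- The flags obtained from `Φ` and `Φ¹` by powers of `σ₁` are closed under changes of vertex and
edge, and these changes connect all flags of the face. -/
theorem exists_image_of_face {Ψ : P.Flag} (hΨ : Ψ.face = Φ.face) :
    ∃ g ∈ Subgroup.zpowers R.σ₁, Ψ = Φ.image g ∨ Ψ = Φ.adj₁.image g := by
  have h1 := Subgroup.mem_zpowers R.σ₁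
  refine Flag.induction_face (p := fun Ψ => ∃ g ∈ Subgroup.zpowers R.σ₁,
    Ψ = Φ.image g ∨ Ψ = Φ.adj₁.image g) ?_ ?_ hΨ ⟨1, one_mem _, Or.inl rfl⟩
  · rintro Θ ⟨g, hg, rfl | rfl⟩
    · exact ⟨_, mul_mem (inv_mem h1) hg, Or.inr (R.image_adj₀ g)⟩
    · exact ⟨_, mul_mem h1 hg, Or.inl (R.image_adj₁_adj₀ g)⟩
  · rintro Θ ⟨g, hg, rfl | rfl⟩
    · exact ⟨_, hg, Or.inr (Flag.image_adj₁ _ g)⟩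
    · exact ⟨_, hg, Or.inl (image_adj₁_adj₁ g)⟩

theorem exists_image_of_vertex {Ψ : P.Flag} (hΨ : Ψ.vertex = Φ.vertex) :
    ∃ g ∈ Subgroup.zpowers R.σ₂, Ψ = Φ.image g ∨ Ψ = Φ.adj₁.image g := by
  have h1 := Subgroup.mem_zpowers R.σ₂
  refine Flag.induction_vertex (p := fun Ψ => ∃ g ∈ Subgroup.zpowers R.σ₂,
    Ψ = Φ.image g ∨ Ψ = Φ.adj₁.image g) ?_ ?_ hΨ ⟨1, one_mem _, Or.inl rfl⟩
  · rintro Θ ⟨g, hg, rfl | rfl⟩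
    · exact ⟨_, hg, Or.inr (Flag.image_adj₁ _ g)⟩
    · exact ⟨_, hg, Or.inl (image_adj₁_adj₁ g)⟩
  · rintro Θ ⟨g, hg, rfl | rfl⟩
    · exact ⟨_, mul_mem h1 hg, Or.inr (R.image_adj₂ g)⟩
    · exact ⟨_, mul_mem (inv_mem h1) hg, Or.inl (R.image_adj₁_adj₂ g)⟩

theorem σ₁_mem : R.σ₁ ∈ R.group := R.gen₁.2

theorem σ₂_mem : R.σ₂ ∈ R.group := R.gen₂.2

/-- The rotation group has at most two orbits on flags, those of `Φ` and `Φ¹`. -/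
theorem exists_image (Ψ : P.Flag) : ∃ g ∈ R.group, Ψ = Φ.image g ∨ Ψ = Φ.adj₁.image g := by
  refine Flag.induction (p := fun Ψ => ∃ g ∈ R.group, Ψ = Φ.image g ∨ Ψ = Φ.adj₁.image g) ?_
    ⟨1, one_mem _, Or.inl rfl⟩ Ψ
  rintro j Θ ⟨g, hg, h⟩
  fin_cases j
  · rcases h with rfl | rfl
    · exact ⟨_, mul_mem (inv_mem R.σ₁_mem) hg, Or.inr (R.image_adj₀ g)⟩
    · exact ⟨_, mul_mem R.σ₁_mem hg, Or.inl (R.image_adj₁_adj₀ g)⟩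
  · rcases h with rfl | rfl
    · exact ⟨_, hg, Or.inr (Flag.image_adj₁ _ g)⟩
    · exact ⟨_, hg, Or.inl (image_adj₁_adj₁ g)⟩
  · rcases h with rfl | rfl
    · exact ⟨_, mul_mem R.σ₂_mem hg, Or.inr (R.image_adj₂ g)⟩
    · exact ⟨_, mul_mem (inv_mem R.σ₂_mem) hg, Or.inl (R.image_adj₁_adj₂ g)⟩

theorem closure_gens : Subgroup.closure {R.gen₁, R.gen₂} = ⊤ := by
  have h := Subgroup.closure_closure_coe_preimage (k := {R.σ₁, R.σ₂})
  refine Eq.trans ?_ h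
  congr 1
  ext x
  simp only [Set.mem_insert_iff, Set.mem_singleton_iff, Subtype.ext_iff]
  rfl

/-- The product sends `Φ` to `(Φ²)⁰`. Changes of vertex and of face commute, so its square fixes
`Φ`, and the action on flags is free. -/
theorem sq_mul : (R.σ₁ * R.σ₂) ^ 2 = 1 := by
  have h : Φ.image (R.σ₁ * R.σ₂) = Φ.adj₂.adj₀ := by
    rw [Flag.image_mul, R.image_σ₁, ← Flag.image_adj₀, ← Flag.image_adj₁, R.image_σ₂,
      Flag.adj₁_adj₁]
  apply Φ.image_injective
  rw [pow_two, Flag.image_mul, h, ← Flag.image_adj₀, ← Flag.image_adj₂, h, Flag.adj₀_adj₂,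
    Flag.adj₂_adj₂, Flag.adj₀_adj₀, Flag.image_one]

/-- An automorphism that sends `Φ` to `Φ¹` inverts the distinguished generators. -/
theorem hasReflection_of_image_eq {g : P.Aut} (hg : Φ.image g = Φ.adj₁) :
    HasReflection R.gen₁ R.gen₂ := by
  -- By freeness it suffices to compare the images of the single flag `Φ¹`.
  have h1 : g⁻¹ * R.σ₁ * g = R.σ₁⁻¹ := by
    apply Φ.adj₁.image_injective
    rw [← R.adj₀_eq, ← hg, mul_assoc, Flag.image_mul, Flag.image_image_inv, Flag.image_mul,
      R.image_σ₁, ← Flag.image_adj₀, ← Flag.image_adj₁, hg, Flag.adj₁_adj₁]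
  have h2 : g⁻¹ * R.σ₂ * g = R.σ₂⁻¹ := by
    apply Φ.adj₁.image_injective
    rw [← Flag.image_adj₁ Φ R.σ₂⁻¹, ← R.adj₁_adj₂_eq, ← hg, mul_assoc, Flag.image_mul,
      Flag.image_image_inv, Flag.image_mul, R.image_σ₂, ← Flag.image_adj₁, ← Flag.image_adj₂]
  have h3 : R.group ≤ R.group.comap (MulAut.conj g⁻¹).toMonoidHom := by
    rw [Rotations.group, Subgroup.closure_le]
    rintro x (rfl | rfl)
    · change g⁻¹ * R.σ₁ * g⁻¹⁻¹ ∈ R.group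
      rw [inv_inv, h1]; exact inv_mem R.σ₁_mem
    · change g⁻¹ * R.σ₂ * g⁻¹⁻¹ ∈ R.group
      rw [inv_inv, h2]; exact inv_mem R.σ₂_mem
  refine ⟨((MulAut.conj g⁻¹).toMonoidHom.comp R.group.subtype).codRestrict R.group
    fun x => h3 x.2, Subtype.ext ?_, Subtype.ext ?_⟩
  · change g⁻¹ * R.σ₁ * g⁻¹⁻¹ = R.σ₁⁻¹
    rw [inv_inv, h1]
  · change g⁻¹ * R.σ₂ * g⁻¹⁻¹ = R.σ₂⁻¹
    rw [inv_inv, h2]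

/-- A polyhedron with rotations but no automorphism inverting them is chiral. -/
theorem isChiral (h : ¬ HasReflection R.gen₁ R.gen₂) : P.IsChiral := by
  have hne : ∀ g : P.Aut, Φ.image g ≠ Φ.adj₁ := fun g hg => h (R.hasReflection_of_image_eq hg)
  have hdis : ∀ g h : P.Aut, Φ.image g ≠ Φ.adj₁.image h := by
    intro g h hgh
    apply hne (g * h⁻¹)
    rw [Flag.image_mul, hgh, Flag.image_image_inv]
  have hin : ∀ g ∈ R.group, Φ.image g ∈ {Ψ | ∃ g ∈ R.group, Ψ = Φ.image g} := fun g hg =>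
    ⟨g, hg, rfl⟩
  have hout : ∀ g : P.Aut, Φ.adj₁.image g ∉ {Ψ | ∃ g ∈ R.group, Ψ = Φ.image g} := by
    rintro g ⟨k, -, hk⟩
    exact hdis k g hk.symm
  -- The orbit of `Φ` under rotations is one class. The orbit of `Φ¹` is the other: no automorphism
  -- joins them, as it would yield a reflection.
  refine ⟨{Ψ | ∃ g ∈ R.group, Ψ = Φ.image g}, fun Ψ₁ Ψ₂ => ?_, fun Ψ => ?_⟩
  · obtain ⟨g₁, hg₁, rfl | rfl⟩ := R.exists_image Ψ₁ <;>
      obtain ⟨g₂, hg₂, rfl | rfl⟩ := R.exists_image Ψ₂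
    · refine iff_of_true ⟨g₁⁻¹ * g₂, ?_⟩ (iff_of_true (hin _ hg₁) (hin _ hg₂))
      rw [Flag.image_mul, Flag.image_image_inv]
    · refine iff_of_false ?_ (fun h => hout g₂ (h.1 (hin _ hg₁)))
      rintro ⟨g, hg⟩
      exact hdis (g₁ * g) g₂ hg
    · refine iff_of_false ?_ (fun h => hout g₁ (h.2 (hin _ hg₂)))
      rintro ⟨g, hg⟩
      exact hdis g₂ (g₁ * g) hg.symm
    · refine iff_of_true ⟨g₁⁻¹ * g₂, ?_⟩ (iff_of_false (hout _) (hout _))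
      rw [Flag.image_mul, Flag.image_image_inv]
  · obtain ⟨g, hg, rfl | rfl⟩ := R.exists_image Ψ
    · have h0 := hin _ hg
      refine ⟨iff_of_false ?_ (not_not.2 h0), iff_of_false ?_ (not_not.2 h0),
        iff_of_false ?_ (not_not.2 h0)⟩
      · rw [R.image_adj₀]; exact hout _
      · rw [Flag.image_adj₁]; exact hout _
      · rw [R.image_adj₂]; exact hout _
    · have h0 := hout g
      refine ⟨iff_of_true ?_ h0, iff_of_true ?_ h0, iff_of_true ?_ h0⟩
      · rw [R.image_adj₁_adj₀]; exact hin _ (mul_mem R.σ₁_mem hg)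
      · rw [image_adj₁_adj₁]; exact hin _ hg
      · rw [R.image_adj₁_adj₂]; exact hin _ (mul_mem (inv_mem R.σ₂_mem) hg)

end Rotations

/-! ### Chirality and tightness read off from the rotation group -/

namespace IsChiral

variable (hP : P.IsChiral) {Φ : P.Flag} (R : Rotations Φ)

include hP

/-- Two successive changes of a flag lead back to its own class, where automorphisms act
transitively. -/
theorem nonempty_rotations (Φ : P.Flag) : Nonempty (Rotations Φ) := by
  obtain ⟨C, hC, hadj⟩ := hP
  obtain ⟨g, hg⟩ := (hC Φ Φ.adj₁.adj₀).2 (by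
    rw [(hadj _).1, (hadj Φ).2.1, not_not])
  obtain ⟨k, hk⟩ := (hC Φ Φ.adj₂.adj₁).2 (by
    rw [(hadj _).2.1, (hadj Φ).2.2, not_not])
  exact ⟨⟨g, k, hg, hk⟩⟩

theorem image_ne_adj (Φ : P.Flag) (g : P.Aut) (i : Fin 3) : Φ.image g ≠ Φ.adj i := by
  obtain ⟨C, hC, hadj⟩ := hP
  intro h
  have h1 := (hC Φ (Φ.adj i)).1 ⟨g, h⟩
  have h2 : Φ.adj i ∈ C ↔ Φ ∉ C := by
    fin_cases i
    exacts [(hadj Φ).1, (hadj Φ).2.1, (hadj Φ).2.2]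
  tauto

theorem image_ne_image_adj₁ (Φ : P.Flag) (g h : P.Aut) : Φ.image g ≠ Φ.adj₁.image h := by
  intro hgh
  apply hP.image_ne_adj Φ (g * h⁻¹) 1
  rw [Flag.image_mul, hgh, Flag.image_image_inv]
  rfl

/-- Freeness and the separation of the two orbits give injectivity. This identification serves both
to count flags and to carry group endomorphisms over to flags. -/
theorem flag_bijective : Function.Bijective
    (fun x : R.group × Bool => (cond x.2 Φ.adj₁ Φ).image (x.1 : P.Aut)) := by
  constructor
  · rintro ⟨g, s⟩ ⟨h, t⟩ hgh
    cases s <;> cases t <;> simp only [cond] at hgh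
    · rw [Subtype.ext (Φ.image_injective hgh)]
    · exact absurd hgh (hP.image_ne_image_adj₁ _ _ _)
    · exact absurd hgh.symm (hP.image_ne_image_adj₁ _ _ _)
    · rw [Subtype.ext (Φ.adj₁.image_injective hgh)]
  · intro Ψ
    obtain ⟨g, hg, rfl | rfl⟩ := R.exists_image Ψ
    exacts [⟨(⟨g, hg⟩, false), rfl⟩, ⟨(⟨g, hg⟩, true), rfl⟩]

/-- The distinguished generators of a chiral polyhedron cannot be inverted simultaneously. -/
theorem not_hasReflection : ¬ HasReflection R.gen₁ R.gen₂ := by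
  rintro ⟨ρ, hρ₁, hρ₂⟩
  have hρρ : ρ.comp ρ = MonoidHom.id _ := by
    apply MonoidHom.eq_of_eqOn_dense R.closure_gens
    rintro x (rfl | rfl)
    · change ρ (ρ _) = _
      rw [hρ₁, map_inv, hρ₁, inv_inv]; rfl
    · change ρ (ρ _) = _
      rw [hρ₂, map_inv, hρ₂, inv_inv]; rfl
  let e := Equiv.ofBijective _ (hP.flag_bijective R)
  -- Apply `ρ` to the group coordinate and exchange `Φ` with `Φ¹`. Adjacency is preserved because
  -- `ρ` inverts the generators, so `f` comes from an automorphism sending `Φ` to `Φ¹`, which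
  -- chirality forbids.
  let f : P.Flag → P.Flag := fun Ψ => e (ρ (e.symm Ψ).1, !(e.symm Ψ).2)
  have hf : ∀ x, f (e x) = e (ρ x.1, !x.2) := by
    intro x
    simp only [f, e.symm_apply_apply]
  have he0 : ∀ g, (e (g, false)).adj 0 = e (R.gen₁⁻¹ * g, true) := fun g => R.image_adj₀ g
  have he0' : ∀ g, (e (g, true)).adj 0 = e (R.gen₁ * g, false) := fun g => R.image_adj₁_adj₀ g
  have he1 : ∀ g, (e (g, false)).adj 1 = e (g, true) := fun g => Flag.image_adj₁ _ _
  have he1' : ∀ g, (e (g, true)).adj 1 = e (g, false) := fun g => Rotations.image_adj₁_adj₁ _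
  have he2 : ∀ g, (e (g, false)).adj 2 = e (R.gen₂ * g, true) := fun g => R.image_adj₂ g
  have he2' : ∀ g, (e (g, true)).adj 2 = e (R.gen₂⁻¹ * g, false) := fun g => R.image_adj₁_adj₂ g
  obtain ⟨g, hg⟩ := exists_aut_of_involution f
    (by
      intro i Ψ
      obtain ⟨⟨g, s⟩, rfl⟩ := e.surjective Ψ
      have h3 : i = 0 ∨ i = 1 ∨ i = 2 := by omega
      rcases h3 with rfl | rfl | rfl <;> cases s <;>
        simp [he0, he0', he1, he1', he2, he2', hf, hρ₁, hρ₂])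
    (by
      intro Ψ
      obtain ⟨⟨g, s⟩, rfl⟩ := e.surjective Ψ
      have : ρ (ρ g) = g := DFunLike.congr_fun hρρ g
      simp [hf, this])
  have h1 : f Φ = Φ.adj₁ := by
    have h2 : e (1, false) = Φ := rfl
    have h3 : e (1, true) = Φ.adj₁ := rfl
    have h4 := hf (1, false)
    rw [map_one, h2] at h4
    exact h4.trans h3
  exact hP.image_ne_adj Φ g 1 ((hg Φ).trans h1)

theorem card_flag : ENat.card P.Flag = ENat.card R.group * 2 := by
  rw [← ENat.card_congr (Equiv.ofBijective _ (hP.flag_bijective R)), ENat.card_prod]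
  congr 1
  simp

/-- The powers of `σ₁` act simply transitively on the edges of the base face: two powers giving the
same edge give flags that are equal or differ in the vertex, and chirality excludes the latter. -/
theorem encard_edges_face : {e | P.rank e = 1 ∧ e < Φ.face}.encard =
    ENat.card (Subgroup.zpowers R.σ₁) := by
  symm
  refine ENat.card_congr (Equiv.ofBijective (fun g : Subgroup.zpowers R.σ₁ =>
    (⟨(Φ.image g.1).edge, (Φ.image g.1).rank_edge, ?_⟩ :
      {e | P.rank e = 1 ∧ e < Φ.face})) ⟨?_, ?_⟩)
  · rw [← R.image_face g.2 Φ rfl]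
    exact (Φ.image g.1).edge_lt_face
  · rintro ⟨g, hg⟩ ⟨h, hh⟩ hgh
    have h1 : (Φ.image g).edge = (Φ.image h).edge := congrArg Subtype.val hgh
    have h2 := (R.image_face hg Φ rfl).trans (R.image_face hh Φ rfl).symm
    rcases Flag.eq_or_adj₀ h1 h2 with h3 | h3
    · exact Subtype.ext (Φ.image_injective h3)
    · rw [R.image_adj₀] at h3
      exact absurd h3 (hP.image_ne_image_adj₁ _ _ _)
  · rintro ⟨e, he, hlt⟩
    obtain ⟨v, hv⟩ := P.exists_vertex he
    obtain ⟨g, hg, h | h⟩ := R.exists_image_of_face (Ψ := Flag.ofLT hv hlt) rfl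
    · exact ⟨⟨g, hg⟩, Subtype.ext (congrArg Flag.edge h).symm⟩
    -- Changing the vertex moves an image of `Φ¹` into the orbit of `Φ` without altering its edge.
    · refine ⟨⟨R.σ₁ * g, mul_mem (Subgroup.mem_zpowers _) hg⟩, Subtype.ext ?_⟩
      have h1 := congrArg Flag.edge h
      simp only
      rw [← R.image_adj₁_adj₀]
      exact h1.symm

theorem encard_edges_vertex : {e | P.rank e = 1 ∧ Φ.vertex < e}.encard =
    ENat.card (Subgroup.zpowers R.σ₂) := by
  symm
  refine ENat.card_congr (Equiv.ofBijective (fun g : Subgroup.zpowers R.σ₂ =>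
    (⟨(Φ.image g.1).edge, (Φ.image g.1).rank_edge, ?_⟩ :
      {e | P.rank e = 1 ∧ Φ.vertex < e})) ⟨?_, ?_⟩)
  · rw [← R.image_vertex g.2 Φ rfl]
    exact (Φ.image g.1).vertex_lt_edge
  · rintro ⟨g, hg⟩ ⟨h, hh⟩ hgh
    have h1 : (Φ.image g).edge = (Φ.image h).edge := congrArg Subtype.val hgh
    have h2 := (R.image_vertex hg Φ rfl).trans (R.image_vertex hh Φ rfl).symm
    rcases Flag.eq_or_adj₂ h2 h1 with h3 | h3
    · exact Subtype.ext (Φ.image_injective h3)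
    · rw [R.image_adj₂] at h3
      exact absurd h3 (hP.image_ne_image_adj₁ _ _ _)
  · rintro ⟨e, he, hlt⟩
    obtain ⟨f, hf⟩ := P.exists_face he
    obtain ⟨g, hg, h | h⟩ := R.exists_image_of_vertex (Ψ := Flag.ofLT hlt hf) rfl
    · exact ⟨⟨g, hg⟩, Subtype.ext (congrArg Flag.edge h).symm⟩
    · refine ⟨⟨R.σ₂⁻¹ * g, mul_mem (inv_mem (Subgroup.mem_zpowers _)) hg⟩, Subtype.ext ?_⟩
      have h1 := congrArg Flag.edge h
      simp only
      rw [← R.image_adj₁_adj₂]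
      exact h1.symm

/-- A common element fixes the base vertex and face, so it sends `Φ` to itself or to `Φ¹`; chirality
leaves only the identity. -/
theorem disjoint_zpowers : Disjoint (Subgroup.zpowers R.σ₁) (Subgroup.zpowers R.σ₂) := by
  rw [Subgroup.disjoint_def]
  intro g h1 h2
  rcases Flag.eq_or_adj₁ (Φ := Φ) (R.image_vertex h2 Φ rfl) (R.image_face h1 Φ rfl) with h | h
  · exact Φ.image_injective h
  · exact absurd h (hP.image_ne_adj Φ g 1)

/-- The generators of the rotation group have the orders given by the type. -/
theorem orderOf_eq {p q : ℕ} (hT : P.HasType p q) : orderOf R.σ₁ = p ∧ orderOf R.σ₂ = q := by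
  have h1 := hT.1 Φ.face Φ.rank_face
  have h2 := hT.2 Φ.vertex Φ.rank_vertex
  rw [hP.encard_edges_face R] at h1
  rw [hP.encard_edges_vertex R] at h2
  rw [← Nat.card_zpowers, ← Nat.card_zpowers, Nat.card, Nat.card]
  exact ⟨by rw [← ENat.toNat_natCast p, ← h1]; rfl, by rw [← ENat.toNat_natCast q, ← h2]; rfl⟩

/-- The type of a chiral polyhedron is given by the orders of the generators. -/
theorem hasType (h₁ : 0 < orderOf R.σ₁) (h₂ : 0 < orderOf R.σ₂) :
    P.HasType (orderOf R.σ₁) (orderOf R.σ₂) := by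
  have hfin₁ : Finite (Subgroup.zpowers R.σ₁) :=
    (orderOf_pos_iff.1 h₁).finite_zpowers
  have hfin₂ : Finite (Subgroup.zpowers R.σ₂) :=
    (orderOf_pos_iff.1 h₂).finite_zpowers
  constructor
  · intro f hf
    obtain ⟨Ψ, hΨ⟩ := P.exists_flag f
    rw [hf] at hΨ
    obtain ⟨g, hg⟩ : ∃ g : P.Aut, f = g.unop Φ.face := by
      obtain ⟨g, -, h | h⟩ := R.exists_image Ψ
      · exact ⟨g, by rw [← hΨ, h]; rfl⟩
      · exact ⟨g, by rw [← hΨ, h]; rfl⟩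
    have himg : {e | P.rank e = 1 ∧ e < f} = g.unop '' {e | P.rank e = 1 ∧ e < Φ.face} := by
      rw [hg]
      ext e
      constructor
      · rintro ⟨h1, h2⟩
        refine ⟨g.unop.symm e, ⟨by rw [rank_apply, h1], ?_⟩, g.unop.apply_symm_apply e⟩
        rwa [← g.unop.lt_iff_lt, g.unop.apply_symm_apply]
      · rintro ⟨e, ⟨h1, h2⟩, rfl⟩
        exact ⟨by rw [rank_apply, h1], g.unop.lt_iff_lt.2 h2⟩
    rw [himg, g.unop.injective.encard_image, hP.encard_edges_face R, ENat.card_eq_coe_natCard,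
      Nat.card_zpowers]
  · intro v hv
    obtain ⟨Ψ, hΨ⟩ := P.exists_flag v
    rw [hv] at hΨ
    obtain ⟨g, hg⟩ : ∃ g : P.Aut, v = g.unop Φ.vertex := by
      obtain ⟨g, -, h | h⟩ := R.exists_image Ψ
      · exact ⟨g, by rw [← hΨ, h]; rfl⟩
      · exact ⟨g, by rw [← hΨ, h]; rfl⟩
    have himg : {e | P.rank e = 1 ∧ v < e} = g.unop '' {e | P.rank e = 1 ∧ Φ.vertex < e} := by
      rw [hg]
      ext e
      constructor
      · rintro ⟨h1, h2⟩
        refine ⟨g.unop.symm e, ⟨by rw [rank_apply, h1], ?_⟩, g.unop.apply_symm_apply e⟩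
        rwa [← g.unop.lt_iff_lt, g.unop.apply_symm_apply]
      · rintro ⟨e, ⟨h1, h2⟩, rfl⟩
        exact ⟨by rw [rank_apply, h1], g.unop.lt_iff_lt.2 h2⟩
    rw [himg, g.unop.injective.encard_image, hP.encard_edges_vertex R, ENat.card_eq_coe_natCard,
      Nat.card_zpowers]

theorem isTight [Finite R.group] (h : IsTightPair R.gen₁ R.gen₂) : P.IsTight := by
  have h1 : orderOf R.gen₁ = orderOf R.σ₁ := (Subgroup.orderOf_coe R.gen₁).symm
  have h2 : orderOf R.gen₂ = orderOf R.σ₂ := (Subgroup.orderOf_coe R.gen₂).symm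
  refine ⟨_, _, hP.hasType R (h1 ▸ orderOf_pos _) (h2 ▸ orderOf_pos _), ?_⟩
  rw [hP.card_flag R, ENat.card_eq_coe_natCard, h.card_eq, h1, h2]
  push_cast
  ring

/-- The number of flags is twice the order of the group, so tightness makes that order `p * q`. The
injective product map `⟨σ₁⟩ × ⟨σ₂⟩ → Γ⁺` is then surjective by counting. -/
theorem isTightPair {p q : ℕ} (hT : P.HasType p q) (htight : P.IsTight) :
    Finite R.group ∧ IsTightPair R.gen₁ R.gen₂ := by
  obtain ⟨p', q', hT', hcard⟩ := htight
  obtain ⟨h1, h2⟩ := hP.orderOf_eq R hT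
  obtain ⟨h1', h2'⟩ := hP.orderOf_eq R hT'
  rw [← h1', ← h2', h1, h2, hP.card_flag R] at hcard
  have hfin : Finite R.group := by
    rw [← not_infinite_iff_finite]
    intro hinf
    rw [ENat.card_eq_top_of_infinite, ENat.top_mul (by norm_num)] at hcard
    exact ENat.natCast_ne_top _ hcard.symm
  refine ⟨hfin, ?_⟩
  have hc : Nat.card R.group = p * q := by
    rw [ENat.card_eq_coe_natCard] at hcard
    have : Nat.card R.group * 2 = 2 * p * q := by exact_mod_cast hcard
    nlinarith
  have h3 : orderOf R.gen₁ = p := (Subgroup.orderOf_coe R.gen₁).symm.trans h1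
  have h4 : orderOf R.gen₂ = q := (Subgroup.orderOf_coe R.gen₂).symm.trans h2
  have hdis : Disjoint (Subgroup.zpowers R.gen₁) (Subgroup.zpowers R.gen₂) := by
    rw [Subgroup.disjoint_def]
    rintro x ⟨i, hi⟩ ⟨j, hj⟩
    apply Subtype.ext
    refine Subgroup.disjoint_def.1 (hP.disjoint_zpowers R) ⟨i, ?_⟩ ⟨j, ?_⟩
    · rw [← hi]; rfl
    · rw [← hj]; rfl
  refine ⟨Subtype.ext R.sq_mul, hdis, ?_⟩
  have hbij := (Subgroup.mul_injective_of_disjoint hdis).bijective_of_nat_card_le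
    (by rw [Nat.card_prod, Nat.card_zpowers, Nat.card_zpowers, h3, h4, hc])
  intro x
  obtain ⟨⟨⟨_, i, rfl⟩, ⟨_, j, rfl⟩⟩, hx⟩ := hbij.surjective x
  exact ⟨i, j, hx.symm⟩

end IsChiral

end AbstractPolyhedron

/-! ### The coset polyhedron of a tight pair -/

section CosetPoint

variable {A : Type u} [Group A] (a b : A)

/-- The stabilizers of the base vertex, edge and face. -/
def cosetSubgroup : Fin 3 → Subgroup A := ![zpowers b, zpowers (a * b), zpowers a]

/-- Two pairs describe the same coset. -/
def cosetSetoid : Setoid (Fin 3 × A) where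
  r x y := x.1 = y.1 ∧ ∃ s ∈ cosetSubgroup a b x.1, y.2 = s * x.2
  iseqv :=
    { refl := fun x => ⟨rfl, 1, one_mem _, (one_mul _).symm⟩
      symm := by
        rintro ⟨i, g⟩ ⟨j, h⟩ ⟨rfl, s, hs, rfl⟩
        exact ⟨rfl, s⁻¹, inv_mem hs, (inv_mul_cancel_left _ _).symm⟩
      trans := by
        rintro ⟨i, g⟩ ⟨j, h⟩ ⟨k, l⟩ ⟨rfl, s, hs, rfl⟩ ⟨rfl, s', hs', rfl⟩
        exact ⟨rfl, s' * s, mul_mem hs' hs, (mul_assoc _ _ _).symm⟩ }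

/-- The right cosets of the three stabilizers. -/
def CosetPoint : Type u := Quotient (cosetSetoid a b)

variable {a b}

namespace CosetPoint

/-- The coset of rank `i` that contains `g`. -/
def coset (i : Fin 3) (g : A) : CosetPoint a b := Quotient.mk (cosetSetoid a b) (i, g)

/-- The rank of a coset. -/
def rank (x : CosetPoint a b) : Fin 3 := Quotient.lift (s := cosetSetoid a b) Prod.fst
  (fun _ _ h => h.1) x

@[simp] theorem rank_coset (i : Fin 3) (g : A) : (coset i g : CosetPoint a b).rank = i := rfl

theorem exists_coset (x : CosetPoint a b) {i : Fin 3} (hx : x.rank = i) : ∃ g, coset i g = x := by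
  induction x using Quotient.ind with
  | _ x => exact ⟨x.2, by rw [← hx]; rfl⟩

theorem coset_eq_coset {i : Fin 3} {g h : A} :
    (coset i g : CosetPoint a b) = coset i h ↔ ∃ s ∈ cosetSubgroup a b i, h = s * g :=
  Quotient.eq.trans ⟨fun h => h.2, fun h => ⟨rfl, h⟩⟩

theorem coset_zero_eq {g h : A} :
    (coset 0 g : CosetPoint a b) = coset 0 h ↔ ∃ n : ℤ, h = b ^ n * g := by
  rw [coset_eq_coset]
  exact ⟨fun ⟨_, ⟨n, hn⟩, hs⟩ => ⟨n, by rw [hs, ← hn]⟩, fun ⟨n, hn⟩ => ⟨_, ⟨n, rfl⟩, hn⟩⟩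

theorem coset_two_eq {g h : A} :
    (coset 2 g : CosetPoint a b) = coset 2 h ↔ ∃ n : ℤ, h = a ^ n * g := by
  rw [coset_eq_coset]
  exact ⟨fun ⟨_, ⟨n, hn⟩, hs⟩ => ⟨n, by rw [hs, ← hn]⟩, fun ⟨n, hn⟩ => ⟨_, ⟨n, rfl⟩, hn⟩⟩

theorem coset_one_eq (hab : (a * b) ^ 2 = 1) {g h : A} :
    (coset 1 g : CosetPoint a b) = coset 1 h ↔ h = g ∨ h = a * b * g := by
  rw [coset_eq_coset]
  constructor
  · rintro ⟨_, ⟨n, rfl⟩, rfl⟩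
    rcases Int.even_or_odd' n with ⟨k, rfl | rfl⟩
    · left
      simp only
      rw [zpow_mul]
      norm_cast
      rw [hab, one_zpow, one_mul]
    · right
      simp only
      rw [zpow_add_one, zpow_mul]
      norm_cast
      rw [hab, one_zpow, one_mul]
  · rintro (rfl | rfl)
    · exact ⟨1, one_mem _, (one_mul _).symm⟩
    · exact ⟨_, mem_zpowers _, rfl⟩

theorem coset_zero_zpow_mul (n : ℤ) (g : A) : (coset 0 (b ^ n * g) : CosetPoint a b) = coset 0 g :=
  (coset_zero_eq.2 ⟨n, rfl⟩).symm

theorem coset_two_zpow_mul (n : ℤ) (g : A) : (coset 2 (a ^ n * g) : CosetPoint a b) = coset 2 g :=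
  (coset_two_eq.2 ⟨n, rfl⟩).symm

theorem coset_one_mul (g : A) : (coset 1 (a * b * g) : CosetPoint a b) = coset 1 g :=
  (coset_eq_coset.2 ⟨_, mem_zpowers _, rfl⟩).symm

/-- Incidence of cosets is having a common element. -/
instance : LT (CosetPoint a b) :=
  ⟨fun x y => x.rank < y.rank ∧ ∃ k, coset x.rank k = x ∧ coset y.rank k = y⟩

theorem lt_iff {x y : CosetPoint a b} {i j : Fin 3} (hx : x.rank = i) (hy : y.rank = j) :
    x < y ↔ i < j ∧ ∃ k, coset i k = x ∧ coset j k = y := by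
  subst hx hy
  rfl

theorem coset_lt_coset {i j : Fin 3} (hij : i < j) {g h : A} (k : A)
    (hg : (coset i k : CosetPoint a b) = coset i g) (hh : (coset j k : CosetPoint a b) = coset j h) :
    (coset i g : CosetPoint a b) < coset j h := ⟨hij, k, hg, hh⟩

/-- Let `g` be common to vertex and edge, and `h` to edge and face. If `h ≠ g` then `h = a * b * g`,
and `b * g` lies in both the vertex and the face. -/
theorem lt_trans' (hab : (a * b) ^ 2 = 1) {x y z : CosetPoint a b} (hxy : x < y) (hyz : y < z) :
    x < z := by
  have h1 : x.rank < y.rank := hxy.1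
  have h2 : y.rank < z.rank := hyz.1
  have hx : x.rank = 0 := by omega
  have hy : y.rank = 1 := by omega
  have hz : z.rank = 2 := by omega
  obtain ⟨-, g, rfl, hg⟩ := (lt_iff hx hy).1 hxy
  obtain ⟨-, h, hh, rfl⟩ := (lt_iff hy hz).1 hyz
  rcases (coset_one_eq hab).1 (hg.trans hh.symm) with rfl | rfl
  · exact coset_lt_coset (by decide) h rfl rfl
  · refine coset_lt_coset (by decide) (b * g) ?_ ?_
    · simpa using coset_zero_zpow_mul 1 g
    · simpa [mul_assoc] using (coset_two_zpow_mul 1 (b * g)).symm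

/-- The incidence order on cosets. -/
@[reducible] def partialOrder (hab : (a * b) ^ 2 = 1) : PartialOrder (CosetPoint a b) where
  lt := (· < ·)
  le x y := x < y ∨ x = y
  le_refl x := Or.inr rfl
  le_trans x y z := by
    rintro (h | rfl) (h' | rfl)
    exacts [Or.inl (lt_trans' hab h h'), Or.inl h, Or.inl h', Or.inr rfl]
  le_antisymm x y := by
    rintro (h | rfl) (h' | h')
    · exact absurd (lt_trans h.1 h'.1) (lt_irrefl _)
    · exact h'.symm
    · rfl
    · rfl
  lt_iff_le_not_ge x y := by
    constructor
    · refine fun h => ⟨Or.inl h, ?_⟩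
      rintro (h' | rfl)
      · exact absurd (lt_trans h.1 h'.1) (lt_irrefl _)
      · exact lt_irrefl _ h.1
    · rintro ⟨h | rfl, h'⟩
      · exact h
      · exact absurd (Or.inr rfl) h'

/-- Right multiplication on cosets. -/
def smul (g : A) : CosetPoint a b → CosetPoint a b :=
  Quotient.map' (s₁ := cosetSetoid a b) (s₂ := cosetSetoid a b) (fun x => (x.1, x.2 * g)) (by
    rintro ⟨i, x⟩ ⟨j, y⟩ ⟨rfl, s, hs, rfl⟩
    exact ⟨rfl, s, hs, mul_assoc _ _ _⟩)

@[simp] theorem smul_coset (g : A) (i : Fin 3) (x : A) :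
    smul g (coset i x : CosetPoint a b) = coset i (x * g) := rfl

theorem smul_smul (g h : A) (x : CosetPoint a b) : smul h (smul g x) = smul (g * h) x := by
  obtain ⟨k, hk⟩ := exists_coset x rfl
  rw [← hk, smul_coset, smul_coset, smul_coset, mul_assoc]

theorem smul_one (x : CosetPoint a b) : smul 1 x = x := by
  obtain ⟨k, hk⟩ := exists_coset x rfl
  rw [← hk, smul_coset, mul_one]

theorem rank_smul (g : A) (x : CosetPoint a b) : (smul g x).rank = x.rank := by
  obtain ⟨k, hk⟩ := exists_coset x rfl
  rw [← hk, smul_coset, rank_coset, rank_coset]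

theorem smul_lt_smul (g : A) {x y : CosetPoint a b} (h : x < y) : smul g x < smul g y := by
  obtain ⟨h1, k, hx, hy⟩ := h
  refine (lt_iff (rank_smul g x) (rank_smul g y)).2 ⟨h1, k * g, ?_, ?_⟩
  · rw [← smul_coset, hx]
  · rw [← smul_coset, hy]

theorem smul_inv_smul (g : A) (x : CosetPoint a b) : smul g⁻¹ (smul g x) = x := by
  rw [smul_smul, mul_inv_cancel, smul_one]

theorem smul_smul_inv (g : A) (x : CosetPoint a b) : smul g (smul g⁻¹ x) = x := by
  rw [smul_smul, inv_mul_cancel, smul_one]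

theorem smul_lt_smul_iff (g : A) {x y : CosetPoint a b} : smul g x < smul g y ↔ x < y := by
  refine ⟨fun h => ?_, smul_lt_smul g⟩
  have := smul_lt_smul g⁻¹ h
  rwa [smul_inv_smul, smul_inv_smul] at this

end CosetPoint

end CosetPoint

namespace IsTightPair

open CosetPoint

variable {A : Type u} [Group A] {a b : A}

theorem zpow_eq_zpow (h : IsTightPair a b) {i j : ℤ} (hij : a ^ i = b ^ j) :
    a ^ i = 1 ∧ b ^ j = 1 := by
  have : a ^ i = 1 := h.eq_one_of_mem ⟨i, rfl⟩ ⟨j, hij.symm⟩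
  exact ⟨this, hij ▸ this⟩

/-- The edge is the coset `{g, a * b * g}`, so its vertices are those of these two elements; their
coincidence would put `a` in `⟨b⟩`. -/
theorem edge_vertices_encard (h : IsTightPair a b) (ha : a ≠ 1) (e : CosetPoint a b)
    (he : e.rank = 1) : {v : CosetPoint a b | v.rank = 0 ∧ v < e}.encard = 2 := by
  obtain ⟨g, rfl⟩ := exists_coset e he
  rw [Set.encard_eq_two]
  refine ⟨coset 0 g, coset 0 (a * b * g), ?_, ?_⟩
  · intro heq
    obtain ⟨n, hn⟩ := coset_zero_eq.1 heq
    have h1 : a ^ (1 : ℤ) = b ^ (n - 1) := by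
      rw [zpow_sub_one, zpow_one, eq_mul_inv_iff_mul_eq]
      exact mul_right_cancel hn
    exact ha (by simpa using (h.zpow_eq_zpow h1).1)
  · ext v
    constructor
    · rintro ⟨hv, hlt⟩
      obtain ⟨-, k, rfl, hk⟩ := (lt_iff hv he).1 hlt
      rcases (coset_one_eq h.sq).1 hk.symm with rfl | rfl
      exacts [Or.inl rfl, Or.inr rfl]
    · rintro (rfl | rfl)
      · exact ⟨rfl, coset_lt_coset (by decide) g rfl rfl⟩
      · exact ⟨rfl, coset_lt_coset (by decide) (a * b * g) rfl (coset_one_mul g)⟩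

theorem edge_faces_encard (h : IsTightPair a b) (hb : b ≠ 1) (e : CosetPoint a b)
    (he : e.rank = 1) : {f : CosetPoint a b | f.rank = 2 ∧ e < f}.encard = 2 := by
  obtain ⟨g, rfl⟩ := exists_coset e he
  rw [Set.encard_eq_two]
  refine ⟨coset 2 g, coset 2 (a * b * g), ?_, ?_⟩
  · intro heq
    obtain ⟨n, hn⟩ := coset_two_eq.1 heq
    have h1 : a ^ (n - 1) = b ^ (1 : ℤ) := by
      have := mul_right_cancel hn
      rw [sub_eq_neg_add, zpow_add, ← this, zpow_neg_one, inv_mul_cancel_left, zpow_one]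
    exact hb (by simpa using (h.zpow_eq_zpow h1).2)
  · ext v
    constructor
    · rintro ⟨hv, hlt⟩
      obtain ⟨-, k, hk, rfl⟩ := (lt_iff he hv).1 hlt
      rcases (coset_one_eq h.sq).1 hk.symm with rfl | rfl
      exacts [Or.inl rfl, Or.inr rfl]
    · rintro (rfl | rfl)
      · exact ⟨rfl, coset_lt_coset (by decide) g rfl rfl⟩
      · exact ⟨rfl, coset_lt_coset (by decide) (a * b * g) (coset_one_mul g) rfl⟩

theorem coset_zero_lt_coset_one (k : A) : (coset 0 k : CosetPoint a b) < coset 1 (a * k) := by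
  refine coset_lt_coset (by decide) (b⁻¹ * k) ?_ ?_
  · simpa using coset_zero_zpow_mul (-1) k
  · rw [← coset_one_mul (b⁻¹ * k)]
    congr 1
    group

theorem vertex_face_edges_encard (h : IsTightPair a b) (ha : a ≠ 1) (hb : b ≠ 1)
    (v f : CosetPoint a b) (hv : v.rank = 0) (hf : f.rank = 2) (hvf : v < f) :
    {e : CosetPoint a b | e.rank = 1 ∧ v < e ∧ e < f}.encard = 2 := by
  obtain ⟨-, k, rfl, rfl⟩ := (lt_iff hv hf).1 hvf
  rw [Set.encard_eq_two]
  refine ⟨coset 1 k, coset 1 (a * k), ?_, ?_⟩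
  · intro heq
    rcases (coset_one_eq h.sq).1 heq with h1 | h1
    · exact ha (mul_eq_right.1 h1)
    · have := mul_right_cancel h1
      exact hb (left_eq_mul.1 this)
  · ext e
    constructor
    · rintro ⟨he, hve, hef⟩
      obtain ⟨-, x, hx, rfl⟩ := (lt_iff hv he).1 hve
      obtain ⟨-, y, hxy, hy⟩ := (lt_iff he hf).1 hef
      obtain ⟨i, rfl⟩ := coset_zero_eq.1 hx.symm
      -- The edge contains `b ^ i * k` and `a ^ j * k`. Either they agree and `a ^ j = 1`, or `a ^
      -- (j - 1) = b ^ (i + 1)` and `a ^ j = a`.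
      obtain ⟨j, rfl⟩ := coset_two_eq.1 hy.symm
      rw [← hxy]
      rcases (coset_one_eq h.sq).1 hxy.symm with h1 | h1
      · have := (h.zpow_eq_zpow (mul_right_cancel h1)).1
        left
        rw [this, one_mul]
      · right
        have h2 : a ^ (j - 1) = b ^ (i + 1) := by
          rw [← mul_assoc] at h1
          have := mul_right_cancel h1
          rw [sub_eq_neg_add, zpow_add, this, zpow_neg_one, mul_assoc, inv_mul_cancel_left,
            zpow_add, zpow_one, ← zpow_one_add, ← zpow_add_one, add_comm]
        have h3 := (h.zpow_eq_zpow h2).1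
        rw [zpow_sub_one, mul_inv_eq_one] at h3
        rw [h3]
        rfl
    · rintro (rfl | rfl)
      · exact ⟨rfl, coset_lt_coset (by decide) k rfl rfl, coset_lt_coset (by decide) k rfl rfl⟩
      · refine ⟨rfl, coset_zero_lt_coset_one k, coset_lt_coset (by decide) (a * k) rfl ?_⟩
        simpa using coset_two_zpow_mul 1 k

/-- The factorization `a ^ i * b ^ j` is itself a path: `b ^ j` lies in the base vertex, and its
face also contains `a ^ i * b ^ j`. -/
theorem cosetGraph_connected (h : IsTightPair a b) :
    (@incidenceGraph (CosetPoint a b) (CosetPoint.partialOrder h.sq)).Connected := by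
  let _ := CosetPoint.partialOrder h.sq
  have hadj : ∀ (i j : Fin 3) (g : A),
      (incidenceGraph (CosetPoint a b)).Reachable (coset i g) (coset j g) := by
    intro i j g
    rcases lt_trichotomy i j with hij | rfl | hij
    · exact SimpleGraph.Adj.reachable (Or.inl (coset_lt_coset hij g rfl rfl))
    · exact SimpleGraph.Reachable.rfl
    · exact SimpleGraph.Adj.reachable (Or.inr (coset_lt_coset hij g rfl rfl))
  rw [SimpleGraph.connected_iff_exists_forall_reachable]
  refine ⟨coset 0 1, fun x => ?_⟩
  obtain ⟨g, hg⟩ := exists_coset x rfl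
  rw [← hg]
  obtain ⟨i, j, rfl⟩ := h.exists_mul g
  have h1 : (coset 0 (b ^ j) : CosetPoint a b) = coset 0 1 := by
    simpa using coset_zero_zpow_mul j (1 : A)
  rw [← h1]
  refine (hadj 0 2 (b ^ j)).trans ?_
  rw [← coset_two_zpow_mul i (b ^ j)]
  exact hadj _ _ _

/-- Links in the coset geometry are zigzags indexed by the exponent of `b` around a vertex, or of
`a` around a face. -/
theorem reachable_of_int {X : Type*} {K : SimpleGraph X} (e f : ℤ → X)
    (h₁ : ∀ n, K.Adj (e n) (f n)) (h₂ : ∀ n, K.Adj (e n) (f (n + 1))) (n : ℤ) :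
    K.Reachable (e 0) (e n) := by
  induction n using Int.induction_on with
  | zero => exact SimpleGraph.Reachable.rfl
  | succ n ih => exact (ih.trans (h₂ _).reachable).trans (h₁ _).symm.reachable
  | pred n ih =>
    refine (ih.trans (h₁ _).reachable).trans (SimpleGraph.Adj.reachable ?_)
    have := (h₂ (-(n : ℤ) - 1)).symm
    rwa [sub_add_cancel] at this

theorem coset_link_connected (h : IsTightPair a b) (x : CosetPoint a b) (hx : x.rank ≠ 1) :
    let _ := CosetPoint.partialOrder h.sq
    ((incidenceGraph (CosetPoint a b)).induce
      ((incidenceGraph (CosetPoint a b)).neighborSet x)).Connected := by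
  intro _
  have hx' : x.rank = 0 ∨ x.rank = 2 := by omega
  rw [SimpleGraph.connected_iff_exists_forall_reachable]
  rcases hx' with hx0 | hx2
  · obtain ⟨g, rfl⟩ := exists_coset x hx0
    have hlt : ∀ (n : ℤ) (j : Fin 3), 0 < j → (coset 0 g : CosetPoint a b) < coset j (b ^ n * g) :=
      fun n j hj => coset_lt_coset hj (b ^ n * g) (coset_zero_zpow_mul n g) rfl
    let e : ℤ → (incidenceGraph (CosetPoint a b)).neighborSet (coset 0 g) := fun n =>
      ⟨coset 1 (b ^ n * g), Or.inl (hlt n 1 (by decide))⟩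
    let f : ℤ → (incidenceGraph (CosetPoint a b)).neighborSet (coset 0 g) := fun n =>
      ⟨coset 2 (b ^ n * g), Or.inl (hlt n 2 (by decide))⟩
    have h₁ : ∀ n, ((incidenceGraph (CosetPoint a b)).induce _).Adj (e n) (f n) := fun n =>
      Or.inl (coset_lt_coset (by decide) (b ^ n * g) rfl rfl)
    have h₂ : ∀ n, ((incidenceGraph (CosetPoint a b)).induce _).Adj (e n) (f (n + 1)) := by
      intro n
      refine Or.inl (coset_lt_coset (by decide) (a * b * (b ^ n * g)) (coset_one_mul _) ?_)
      have := coset_two_zpow_mul (a := a) (b := b) 1 (b ^ (n + 1) * g)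
      rw [← this, zpow_one, add_comm, zpow_one_add]
      simp only [mul_assoc]
    refine ⟨e 0, ?_⟩
    rintro ⟨y, hy | hy⟩
    · have hr : y.rank = 1 ∨ y.rank = 2 := by
        have : (0 : Fin 3) < y.rank := hy.1
        omega
      rcases hr with hr | hr
      · obtain ⟨-, k, hk, rfl⟩ := (lt_iff rfl hr).1 hy
        obtain ⟨n, rfl⟩ := coset_zero_eq.1 hk.symm
        exact reachable_of_int e f h₁ h₂ n
      · obtain ⟨-, k, hk, rfl⟩ := (lt_iff rfl hr).1 hy
        obtain ⟨n, rfl⟩ := coset_zero_eq.1 hk.symm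
        exact (reachable_of_int e f h₁ h₂ n).trans (h₁ n).reachable
    · exact absurd hy.1 (Fin.not_lt_zero _)
  · obtain ⟨g, rfl⟩ := exists_coset x hx2
    have hlt : ∀ (n : ℤ) (j : Fin 3), j < 2 → (coset j (a ^ n * g) : CosetPoint a b) < coset 2 g :=
      fun n j hj => coset_lt_coset hj (a ^ n * g) rfl (coset_two_zpow_mul n g)
    let e : ℤ → (incidenceGraph (CosetPoint a b)).neighborSet (coset 2 g) := fun n =>
      ⟨coset 0 (a ^ n * g), Or.inr (hlt n 0 (by decide))⟩
    let f : ℤ → (incidenceGraph (CosetPoint a b)).neighborSet (coset 2 g) := fun n =>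
      ⟨coset 1 (a ^ n * g), Or.inr (hlt n 1 (by decide))⟩
    have h₁ : ∀ n, ((incidenceGraph (CosetPoint a b)).induce _).Adj (e n) (f n) := fun n =>
      Or.inl (coset_lt_coset (by decide) (a ^ n * g) rfl rfl)
    have h₂ : ∀ n, ((incidenceGraph (CosetPoint a b)).induce _).Adj (e n) (f (n + 1)) := by
      intro n
      have := coset_zero_lt_coset_one (a := a) (b := b) (a ^ n * g)
      rw [← mul_assoc, ← zpow_one_add, add_comm] at this
      exact Or.inl this
    refine ⟨e 0, ?_⟩
    rintro ⟨y, hy | hy⟩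
    · have h1 : (2 : Fin 3) < y.rank := hy.1
      omega
    · have hr : y.rank = 0 ∨ y.rank = 1 := by
        have : y.rank < (2 : Fin 3) := hy.1
        omega
      rcases hr with hr | hr
      · obtain ⟨-, k, rfl, hk⟩ := (lt_iff hr rfl).1 hy
        obtain ⟨n, rfl⟩ := coset_two_eq.1 hk.symm
        exact reachable_of_int e f h₁ h₂ n
      · obtain ⟨-, k, rfl, hk⟩ := (lt_iff hr rfl).1 hy
        obtain ⟨n, rfl⟩ := coset_two_eq.1 hk.symm
        exact (reachable_of_int e f h₁ h₂ n).trans (h₁ n).reachable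

/-- The polyhedron of cosets of the subgroups `⟨b⟩`, `⟨ab⟩` and `⟨a⟩`. -/
def cosetPolyhedron (h : IsTightPair a b) (ha : a ≠ 1) (hb : b ≠ 1) : AbstractPolyhedron.{u} :=
  letI := CosetPoint.partialOrder h.sq
  { carrier := CosetPoint a b
    rank := CosetPoint.rank
    rank_strictMono := fun _ _ hxy => ((CosetPoint.lt_iff (a := a) (b := b) rfl rfl).1 hxy).1
    edge_vertices := h.edge_vertices_encard ha
    edge_faces := h.edge_faces_encard hb
    vertex_face_edges := h.vertex_face_edges_encard ha hb
    connected := h.cosetGraph_connected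
    link_connected := h.coset_link_connected }

section

variable (h : IsTightPair a b) (ha : a ≠ 1) (hb : b ≠ 1)

/-- Right multiplication as an automorphism. -/
def cosetAut : A →* (h.cosetPolyhedron ha hb).Aut where
  toFun g := MulOpposite.op
    { toFun := CosetPoint.smul g
      invFun := CosetPoint.smul g⁻¹
      left_inv := CosetPoint.smul_inv_smul g
      right_inv := CosetPoint.smul_smul_inv g
      map_rel_iff' := or_congr (CosetPoint.smul_lt_smul_iff g)
        (Function.LeftInverse.injective (CosetPoint.smul_inv_smul g)).eq_iff }
  map_one' := MulOpposite.unop_injective (RelIso.ext fun x => CosetPoint.smul_one x)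
  map_mul' g k := MulOpposite.unop_injective
    (RelIso.ext fun x => (CosetPoint.smul_smul g k x).symm)

/-- The flag of the cosets that contain `g`. -/
def cosetFlag (g : A) : (h.cosetPolyhedron ha hb).Flag where
  vertex := CosetPoint.coset 0 g
  edge := CosetPoint.coset 1 g
  face := CosetPoint.coset 2 g
  rank_vertex := rfl
  rank_edge := rfl
  rank_face := rfl
  vertex_lt_edge := coset_lt_coset (by decide) g rfl rfl
  edge_lt_face := coset_lt_coset (by decide) g rfl rfl

theorem cosetFlag_image (g k : A) :
    (h.cosetFlag ha hb g).image (h.cosetAut ha hb k) = h.cosetFlag ha hb (g * k) := rfl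

/-- An element acting trivially fixes the base vertex and the base face, so it lies in `⟨b⟩ ∩ ⟨a⟩`.
-/
theorem cosetAut_injective : Function.Injective (h.cosetAut ha hb) := by
  rw [injective_iff_map_eq_one]
  intro g hg
  have h1 := h.cosetFlag_image ha hb 1 g
  rw [hg, AbstractPolyhedron.Flag.image_one, one_mul] at h1
  obtain ⟨i, hi⟩ := coset_zero_eq.1 (congrArg AbstractPolyhedron.Flag.vertex h1)
  obtain ⟨j, hj⟩ := coset_two_eq.1 (congrArg AbstractPolyhedron.Flag.face h1)
  rw [mul_one] at hi hj
  rw [hj]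
  exact (h.zpow_eq_zpow (hj.symm.trans hi)).1

/-- The rotations of the coset polyhedron. -/
def cosetRotations : AbstractPolyhedron.Rotations (h.cosetFlag ha hb 1) where
  σ₁ := h.cosetAut ha hb a
  σ₂ := h.cosetAut ha hb b
  image_σ₁ := by
    have e2 : (coset 2 a : CosetPoint a b) = coset 2 1 := by simpa using coset_two_zpow_mul 1 (1 : A)
    have hlt : (coset 0 1 : CosetPoint a b) < coset 1 a := by simpa using coset_zero_lt_coset_one (1 : A)
    have hlt' : (coset 1 a : CosetPoint a b) < coset 2 1 := coset_lt_coset (by decide) a rfl e2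
    -- This is `Φ¹` for the base flag: the second edge at its vertex and face is the coset of `a`.
    let Θ : (h.cosetPolyhedron ha hb).Flag := ⟨coset 0 1, coset 1 a, coset 2 1, rfl, rfl, rfl, hlt, hlt'⟩
    have h1 : (h.cosetFlag ha hb 1).adj₁ = Θ := by
      refine AbstractPolyhedron.Flag.adj₁_eq rfl ?_ rfl
      intro heq
      rcases (coset_one_eq h.sq).1 heq.symm with h1 | h1
      · exact ha h1
      · rw [mul_one] at h1
        exact hb (left_eq_mul.1 h1)
    have h2 : Θ.adj₀ = h.cosetFlag ha hb a := by
      refine AbstractPolyhedron.Flag.adj₀_eq ?_ rfl e2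
      intro heq
      obtain ⟨n, hn⟩ := coset_zero_eq.1 heq.symm
      rw [mul_one, ← zpow_one a] at hn
      exact ha (by simpa using (h.zpow_eq_zpow hn).1)
    rw [h1, h2, cosetFlag_image, one_mul]
  image_σ₂ := by
    have e0 : (coset 0 b : CosetPoint a b) = coset 0 1 := by simpa using coset_zero_zpow_mul 1 (1 : A)
    have e2 : (coset 2 (a * b) : CosetPoint a b) = coset 2 b := by simpa using coset_two_zpow_mul 1 b
    have hlt : (coset 0 1 : CosetPoint a b) < coset 1 1 := coset_lt_coset (by decide) 1 rfl rfl
    have hlt' : (coset 1 1 : CosetPoint a b) < coset 2 b :=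
      coset_lt_coset (by decide) (a * b) (by simpa using coset_one_mul (1 : A)) e2
    let Θ : (h.cosetPolyhedron ha hb).Flag := ⟨coset 0 1, coset 1 1, coset 2 b, rfl, rfl, rfl, hlt, hlt'⟩
    have h1 : (h.cosetFlag ha hb 1).adj₂ = Θ := by
      refine AbstractPolyhedron.Flag.adj₂_eq rfl rfl ?_
      intro heq
      obtain ⟨n, hn⟩ := coset_two_eq.1 heq.symm
      rw [mul_one, ← zpow_one b] at hn
      exact hb (by simpa using (h.zpow_eq_zpow hn.symm).2)
    have h2 : Θ.adj₁ = h.cosetFlag ha hb b := by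
      refine AbstractPolyhedron.Flag.adj₁_eq e0 ?_ rfl
      intro heq
      rcases (coset_one_eq h.sq).1 heq.symm with h1 | h1
      · exact hb h1
      · rw [mul_one] at h1
        exact ha (right_eq_mul.1 h1)
    rw [h1, h2, cosetFlag_image, one_mul]

theorem closure_eq_top (h : IsTightPair a b) : Subgroup.closure {a, b} = ⊤ := by
  rw [eq_top_iff]
  intro x _
  obtain ⟨i, j, rfl⟩ := h.exists_mul x
  have h₁ : a ∈ Subgroup.closure {a, b} := Subgroup.subset_closure (Or.inl rfl)
  have h₂ : b ∈ Subgroup.closure {a, b} := Subgroup.subset_closure (Or.inr rfl)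
  exact mul_mem (zpow_mem h₁ _) (zpow_mem h₂ _)

theorem cosetRotations_group : (h.cosetRotations ha hb).group = (h.cosetAut ha hb).range := by
  rw [MonoidHom.range_eq_map, ← h.closure_eq_top, MonoidHom.map_closure, Set.image_pair]
  rfl

end

/-- Every tight pair of nontrivial elements consists of the distinguished generators of the
rotation group of a polyhedron. -/
theorem exists_polyhedron (h : IsTightPair a b) (ha : a ≠ 1) (hb : b ≠ 1) :
    ∃ (Q : AbstractPolyhedron.{u}) (Ψ : Q.Flag) (S : AbstractPolyhedron.Rotations Ψ)
      (e : A ≃* S.group), e a = S.gen₁ ∧ e b = S.gen₂ :=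
  ⟨h.cosetPolyhedron ha hb, h.cosetFlag ha hb 1, h.cosetRotations ha hb,
    (MonoidHom.ofInjective (h.cosetAut_injective ha hb)).trans
      (MulEquiv.subgroupCongr (h.cosetRotations_group ha hb).symm), rfl, rfl⟩

end IsTightPair

/-! ### Transfer along isomorphisms, and quotients of tight pairs -/

theorem HasReflection.of_mulEquiv {G H : Type*} [Group G] [Group H] {a b : G} {c d : H}
    (e : G ≃* H) (hc : e a = c) (hd : e b = d) (h : HasReflection c d) : HasReflection a b := by
  obtain ⟨ρ, h₁, h₂⟩ := h
  subst hc hd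
  refine ⟨(e.symm.toMonoidHom.comp ρ).comp e.toMonoidHom, ?_, ?_⟩
  · change e.symm (ρ (e a)) = a⁻¹
    rw [h₁, map_inv, e.symm_apply_apply]
  · change e.symm (ρ (e b)) = b⁻¹
    rw [h₂, map_inv, e.symm_apply_apply]

namespace IsTightPair

theorem map_mulEquiv {G H : Type*} [Group G] [Group H] {a b : G} {c d : H} (h : IsTightPair a b)
    (e : G ≃* H) (hc : e a = c) (hd : e b = d) : IsTightPair c d := by
  subst hc hd
  refine ⟨by rw [← map_mul, ← map_pow, h.sq, map_one], ?_, fun x => ?_⟩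
  · rw [Subgroup.disjoint_def]
    rintro x ⟨i, rfl⟩ ⟨j, hj⟩
    simp only at hj ⊢
    rw [← map_zpow, ← map_zpow] at hj
    rw [← map_zpow, (h.zpow_eq_zpow (e.injective hj).symm).1, map_one]
  · obtain ⟨i, j, hij⟩ := h.exists_mul (e.symm x)
    exact ⟨i, j, by rw [← map_zpow, ← map_zpow, ← map_mul, ← hij, e.apply_symm_apply]⟩

variable {G : Type*} [Group G] {a b : G} (h : IsTightPair a b) (N : Subgroup G) [N.Normal]

-- If `a ^ i` and `b ^ j` agree modulo `N`, then `b ^ (-j) * a ^ i` lies in `N`. When `N ≤ ⟨a⟩` this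
-- puts `b ^ j` in `⟨a⟩`, hence makes it trivial; the other case is symmetric.
include h in
theorem quotient (hN : N ≤ zpowers a ∨ N ≤ zpowers b) :
    IsTightPair (a : G ⧸ N) (b : G ⧸ N) := by
  refine ⟨?_, ?_, fun x => ?_⟩
  · have := congrArg (QuotientGroup.mk' N) h.sq
    exact this
  · rw [Subgroup.disjoint_def]
    rintro x ⟨i, rfl⟩ ⟨j, hj⟩
    simp only at hj ⊢
    have hmem : b ^ (-j) * a ^ i ∈ N := by
      rw [zpow_neg, ← QuotientGroup.eq]
      exact hj
    rcases hN with hN | hN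
    · have h1 : b ^ (-j) ∈ zpowers a := (mul_mem_cancel_right (zpow_mem (mem_zpowers a) i)).1 (hN hmem)
      have h2 := h.eq_one_of_mem h1 ⟨-j, rfl⟩
      rw [zpow_neg, inv_eq_one] at h2
      rw [← hj, ← QuotientGroup.mk_zpow, h2, QuotientGroup.mk_one]
    · have h1 : a ^ i ∈ zpowers b := (mul_mem_cancel_left (zpow_mem (mem_zpowers b) (-j))).1 (hN hmem)
      have h2 := h.eq_one_of_mem (zpow_mem (mem_zpowers a) i) h1
      rw [← QuotientGroup.mk_zpow, h2, QuotientGroup.mk_one]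
  · obtain ⟨g, rfl⟩ := QuotientGroup.mk_surjective x
    obtain ⟨i, j, rfl⟩ := h.exists_mul g
    exact ⟨i, j, rfl⟩

theorem orderOf_mk_eq {x : G} (hx : Disjoint (zpowers x) N) :
    orderOf (x : G ⧸ N) = orderOf x := by
  rw [orderOf_eq_orderOf_iff]
  intro n
  rw [← QuotientGroup.mk_pow, QuotientGroup.eq_one_iff]
  refine ⟨fun hn => Subgroup.disjoint_def.1 hx (npow_mem_zpowers x n) hn, fun hn => ?_⟩
  rw [hn]
  exact one_mem N

include h in
/-- A proper quotient of a tight pair keeps one of the two orders and lowers the other. -/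
theorem orderOf_quotient [Finite G] (hne : N ≠ ⊥) (hN : N ≤ zpowers a ∨ N ≤ zpowers b) :
    (orderOf (a : G ⧸ N) < orderOf a ∧ orderOf (b : G ⧸ N) = orderOf b) ∨
    (orderOf (a : G ⧸ N) = orderOf a ∧ orderOf (b : G ⧸ N) < orderOf b) := by
  have hcard : Nat.card (G ⧸ N) < Nat.card G := by
    rw [Subgroup.card_eq_card_quotient_mul_card_subgroup N]
    exact lt_mul_of_one_lt_right Nat.card_pos (N.one_lt_card_iff_ne_bot.2 hne)
  rw [h.card_eq, (h.quotient N hN).card_eq] at hcard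
  -- The generator whose powers meet `N` trivially keeps its order, so the drop in the product of
  -- the orders falls on the other one.
  rcases hN with hN | hN
  · have h1 := orderOf_mk_eq N (h.disjoint.symm.mono_right hN)
    rw [h1] at hcard
    exact Or.inl ⟨lt_of_mul_lt_mul_right hcard (Nat.zero_le _), h1⟩
  · have h1 := orderOf_mk_eq N (h.disjoint.mono_right hN)
    rw [h1] at hcard
    exact Or.inr ⟨h1, lt_of_mul_lt_mul_left hcard (Nat.zero_le _)⟩

end IsTightPair

/-! ### From atomic polyhedra to groups, and the conclusion -/

namespace AbstractPolyhedron

/-- The quotients of the rotation group of an atomic chiral polyhedron by nontrivial normal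
subgroups of `⟨σ₁⟩` or `⟨σ₂⟩` have reflections. -/
theorem IsAtomicChiral.hasReflection_quotient {P : AbstractPolyhedron.{u}} {p q : ℕ}
    (hP : P.IsAtomicChiral p q) {Φ : P.Flag} (R : Rotations Φ) (N : Subgroup R.group) [N.Normal]
    (hne : N ≠ ⊥) (hN : N ≤ zpowers R.gen₁ ∨ N ≤ zpowers R.gen₂) (h₁ : R.gen₁ ∉ N)
    (h₂ : R.gen₂ ∉ N) :
    HasReflection (R.gen₁ : R.group ⧸ N) (R.gen₂ : R.group ⧸ N) := by
  obtain ⟨hT, hch, htight, hat⟩ := hP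
  obtain ⟨hfin, hpair⟩ := hch.isTightPair R hT htight
  obtain ⟨ho₁, ho₂⟩ := hch.orderOf_eq R hT
  have ho₁' : orderOf R.gen₁ = p := (Subgroup.orderOf_coe R.gen₁).symm.trans ho₁
  have ho₂' : orderOf R.gen₂ = q := (Subgroup.orderOf_coe R.gen₂).symm.trans ho₂
  have hq := hpair.quotient N hN
  obtain ⟨Q, Ψ, S, e, he₁, he₂⟩ := hq.exists_polyhedron
    (mt (QuotientGroup.eq_one_iff _).1 h₁) (mt (QuotientGroup.eq_one_iff _).1 h₂)
  -- Without a reflection, the coset polyhedron of the quotient would be tight and chiral, of a type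
  -- with one entry smaller and the other unchanged, and covered by `P` through the projection.
  by_contra hno
  have hQ : Q.IsChiral := S.isChiral fun h => hno (h.of_mulEquiv e he₁ he₂)
  have hfinS : Finite S.group := Finite.of_equiv _ e.toEquiv
  have hs₁ : orderOf S.σ₁ = orderOf (R.gen₁ : R.group ⧸ N) := by
    rw [← e.orderOf_eq, he₁]; exact Subgroup.orderOf_coe S.gen₁
  have hs₂ : orderOf S.σ₂ = orderOf (R.gen₂ : R.group ⧸ N) := by
    rw [← e.orderOf_eq, he₂]; exact Subgroup.orderOf_coe S.gen₂
  have hQT := hQ.hasType S (hs₁ ▸ orderOf_pos _) (hs₂ ▸ orderOf_pos _)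
  rw [hs₁, hs₂] at hQT
  have ho := hpair.orderOf_quotient N hne hN
  rw [ho₁', ho₂'] at ho
  refine hat Q hQ (hQ.isTight S (hq.map_mulEquiv e he₁ he₂)) ?_
    ⟨Φ, Ψ, R, S, e.toMonoidHom.comp (QuotientGroup.mk' N), he₁, he₂⟩
  rcases ho with ⟨hlt, heq⟩ | ⟨heq, hlt⟩
  · exact Or.inl ⟨_, hlt, heq ▸ hQT⟩
  · exact Or.inr ⟨_, hlt, heq ▸ hQT⟩

end AbstractPolyhedron

theorem mainTheorem5 (P : AbstractPolyhedron.{u}) (m α β : ℕ) (hm : m.Prime) (hm_odd : Odd m)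
    (hα : 1 ≤ α) (hβ : 1 ≤ β) (hP : P.IsAtomicChiral (2 * m ^ α) (m ^ (α + β))) :
    α = 1 ∧
      ∀ Φ : P.Flag, ∃ k : ℕ, 1 ≤ k ∧ k ≤ m - 1 ∧
        AbstractPolyhedron.RotationGroupEq Φ (2 * m) (m ^ (β + 1))
          3 (1 + (k : ℤ) * (m : ℤ) ^ β) (-3) (-1 + (k : ℤ) * (m : ℤ) ^ β) := by
  have key : ∀ Φ : P.Flag, α = 1 ∧ ∃ k : ℕ, 1 ≤ k ∧ k ≤ m - 1 ∧
      AbstractPolyhedron.RotationGroupEq Φ (2 * m ^ α) (m ^ (α + β))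
        3 (1 + (k : ℤ) * (m : ℤ) ^ β) (-3) (-1 + (k : ℤ) * (m : ℤ) ^ β) := by
    intro Φ
    obtain ⟨hT, hch, htight, -⟩ := id hP
    obtain ⟨R⟩ := hch.nonempty_rotations Φ
    obtain ⟨hfin, hpair⟩ := hch.isTightPair R hT htight
    obtain ⟨ho₁, ho₂⟩ := hch.orderOf_eq R hT
    have ho₁' := (Subgroup.orderOf_coe R.gen₁).symm.trans ho₁
    have ho₂' := (Subgroup.orderOf_coe R.gen₂).symm.trans ho₂
    obtain ⟨h1, k, hk1, hk2, r₁, r₂⟩ := hpair.relations_of_atomic hm hm_odd hα hβ ho₁' ho₂'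
      (hch.not_hasReflection R) (fun N _ => hP.hasReflection_quotient R N)
    exact ⟨h1, k, hk1, hk2, R, hpair.exists_mulEquiv ho₁' ho₂' _ r₁ r₂⟩
  -- The equality comes from the analysis at a flag, and flags exist because the polyhedron is
  -- nonempty.
  have h1 : α = 1 := (key (Classical.arbitrary _)).1
  refine ⟨h1, fun Φ => ?_⟩
  obtain ⟨-, k, hk1, hk2, hk⟩ := key Φ
  rw [h1, pow_one, add_comm 1 β] at hk
  exact ⟨k, hk1, hk2, hk⟩
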